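/- Let $(z;q)_\infty=\prod_{j\ge 0}(1-zq^j)$ for $|q|<1$, let $B_k$ be the Bernoulli numbers ($B_1=-\tfrac12$), and for $N\ge 1$ define the Stirling remainder $f_N$ by $$\log\Gamma(x)=\left(x-\tfrac12\right)\log x-x+\tfrac12\log(2\pi)+\sum_{k=1}^N\frac{B_{2k}}{2k(2k-1)x^{2k-1}}+f_N(x),$$ with principal branches for $x\in\mathbb C\setminus(-\infty,0]$. For $\operatorname{Re}\omega>0$ put $D_\omega=\mathbb C\setminus(2\pi\mathrm i\mathbb Z+\omega\mathbb R_{\le 0})$, and for integers $s\le 2$ let $\operatorname{Li}_s(e^{-y})$ denote on $D_\omega$ the analytic continuation of $\sum_{j\ge1}e^{-jy}/j^s$ from the half-plane $\operatorname{Re}y>0$ (this continuation exists). Every $y\notin 2\pi\mathrm i\mathbb Z$ lies in some $D_\omega$ with $\operatorname{Re}\omega>0$. Let $N\ge1$, $\operatorname{Re}\beta>0$ and $y\notin2\pi\mathrm i\mathbb Z$. Then $$(e^{-y};e^{-\beta})_\infty=\exp\left(\sum_{k=0}^{2N}\frac{B_k\operatorname{Li}_{2-k}(e^{-y})(-\beta)^{k-1}}{k!}-\sum_{n\in\mathbb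 Z}f_N\left(\frac{y+2\pi\mathrm i n}{\beta}\right)\right)$$ in the following sense. (a) If $y\in D_\beta$, the identity holds with the principal $f_N$ and with the branches of $\operatorname{Li}_s(e^{-y})$ on $D_\beta$, and the sum over $n$ converges absolutely. (b) Let $\operatorname{Re}\omega>0$ and $y\in D_\omega$. Use the branches of $\operatorname{Li}_s(e^{-y})$ on $D_\omega$ and the branch of $\log\frac{y+2\pi\mathrm i n}{\beta}$ that is analytic on $D_\omega$ and principal for $\operatorname{Re}y>0$. Then the identity holds with $\exp(-\sum_n f_N)$ read as the convergent product $\prod_{n\in\mathbb Z}\exp(-f_N(\frac{y+2\pi\mathrm i n}{\beta}))$, where $$\exp(-f_N(x))=\frac{\sqrt{2\pi}}{\Gamma(x)}\exp\left(\left(x-\tfrac12\right)\log x-x+\sum_{k=1}^N\frac{B_{2k}}{2k(2k-1)x^{2k-1}}\right)$$ (equal to $0$ at the poles of $\Gamma$). If moreover no $\frac{y+2\pi\mathrm i n}{\beta}$ is a pole of $\Gamma$, the identity holds as displayed, with absolutely convergent sum over $n$, for every choice of values of $\log\Gamma(\frac{y+2\pi\mathrm i n}{\beta})$ that is principal for all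 but finitely many $n$. (c) The case $N=1$ reads, with the same branches as in (b) and $(1-e^{-y})^{1/2}=\exp(-\tfrac12\operatorname{Li}_1(e^{-y}))$, $$(e^{-y};e^{-\beta})_\infty=\exp\left(\frac{\beta(1-\coth(y/2))}{24}-\frac{\operatorname{Li}_2(e^{-y})}{\beta}\right)(1-e^{-y})^{1/2}\prod_{n\in\mathbb Z}\left(\frac{\sqrt{2\pi}}{\Gamma(x_n)}\,x_n^{x_n-\frac12}\exp\left(\frac{\beta}{12(y+2\pi\mathrm i n)}-x_n\right)\right),\qquad x_n=\frac{y+2\pi\mathrm i n}{\beta},$$ where the product converges. -/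

import Mathlib

noncomputable section

/-- The infinite `q`-Pochhammer symbol `(z;q)_∞ = ∏_{j ≥ 0} (1 - z q^j)`. -/
def qPochhammerInf (z q : ℂ) : ℂ := ∏' j : ℕ, (1 - z * q ^ j)

/-- The polylogarithm series `Li_s(z) = ∑_{j ≥ 1} z^j / j^s` (used for `|z| < 1`). -/
def polylogSeries (s : ℤ) (z : ℂ) : ℂ := ∑' j : ℕ, z ^ (j + 1) / ((j + 1 : ℕ) : ℂ) ^ s

/-- The plane with the rays `2πin + ω ℝ_{≤ 0}`, `n ∈ ℤ`, removed. For `Re ω > 0` it is a connected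
open set containing the half-plane `Re y > 0`. -/
def cutPlane (ω : ℂ) : Set ℂ :=
  {y | ∀ (n : ℤ) (t : ℝ), 0 ≤ t → y ≠ 2 * Real.pi * Complex.I * n - t * ω}

/-- `F` is the branch of `y ↦ Li_s(e^{-y})` on the cut plane: it is analytic there and is given by
the polylogarithm series in the half-plane `Re y > 0`. (By the identity theorem this determines
`F` on the cut plane.) -/
def IsPolylogBranch (ω : ℂ) (s : ℤ) (F : ℂ → ℂ) : Prop :=
  AnalyticOnNhd ℂ F (cutPlane ω) ∧
    ∀ y : ℂ, 0 < y.re → F y = polylogSeries s (Complex.exp (-y))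

/-- The point `(y + 2πin) / β`. -/
def latticePoint (β y : ℂ) (n : ℤ) : ℂ := (y + 2 * Real.pi * Complex.I * n) / β

/-- The branch of `y ↦ log ((y + 2πin) / β)` which is analytic on `cutPlane ω` and
equals the principal logarithm for `Re y > 0` (where `Re ω > 0` and `Re β > 0`). -/
def latticeLog (ω β y : ℂ) (n : ℤ) : ℂ :=
  Complex.log ((y + 2 * Real.pi * Complex.I * n) / ω) + Complex.log (ω / β)

/-- The principal branch of `log Γ`, analytic on `ℂ ∖ (-∞, 0]` and real on `(0, ∞)`, by
Weierstrass' formula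
`log Γ(x) = -γ x - log x + ∑_{m ≥ 1} (x / m - log (1 + x / m))`. -/
def logGamma (x : ℂ) : ℂ :=
  -(Real.eulerMascheroniConstant : ℂ) * x - Complex.log x +
    ∑' m : ℕ, (x / ((m + 1 : ℕ) : ℂ) - Complex.log (1 + x / ((m + 1 : ℕ) : ℂ)))

/-- `∑_{k=1}^N B_{2k} / (2k (2k-1) x^{2k-1})`. -/
def stirlingSum (N : ℕ) (x : ℂ) : ℂ :=
  ∑ k ∈ Finset.Icc 1 N,
    ((bernoulli (2 * k) : ℚ) : ℂ) / (2 * (k : ℂ) * (2 * (k : ℂ) - 1) * x ^ (2 * k - 1))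

/-- The remainder of order `N` in Stirling's formula, computed with the value `l` of `log x` and
the value `g` of `log Γ(x)`:
`g = (x - 1/2) l - x + (1/2) log (2π) + ∑_{k=1}^N B_{2k} / (2k (2k-1) x^{2k-1}) + f_N`. -/
def stirlingRemainderOf (N : ℕ) (x l g : ℂ) : ℂ :=
  g - ((x - 1 / 2) * l - x + (1 / 2) * (Real.log (2 * Real.pi) : ℂ) + stirlingSum N x)

/-- The remainder `f_N(x)` with principal branches, analytic on `ℂ ∖ (-∞, 0]`. -/
def stirlingRemainder (N : ℕ) (x : ℂ) : ℂ :=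
  stirlingRemainderOf N x (Complex.log x) (logGamma x)

/-- The factor `exp (-f_N(x))`, computed with the value `l` of `log x`. It has the value `0` at the
poles of `Γ` (where `Complex.Gamma` is `0`, so that its inverse is the value `0` of `1 / Γ`). -/
def stirlingFactor (N : ℕ) (x l : ℂ) : ℂ :=
  (Real.sqrt (2 * Real.pi) : ℂ) * (Complex.Gamma x)⁻¹ *
    Complex.exp ((x - 1 / 2) * l - x + stirlingSum N x)

/-- `∑_{k=0}^{2N} B_k Li_{2-k}(e^{-y}) (-β)^{k-1} / k!`, where `L s y` is the value used for
`Li_s(e^{-y})`; the Bernoulli numbers have `B_1 = -1/2`. -/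
def polylogSum (L : ℤ → ℂ → ℂ) (N : ℕ) (β y : ℂ) : ℂ :=
  ∑ k ∈ Finset.range (2 * N + 1),
    ((bernoulli k : ℚ) : ℂ) * L (2 - (k : ℤ)) y * (-β) ^ ((k : ℤ) - 1) / (k.factorial : ℂ)

end

/-! Take first N = 1 and Re y > 0. The difference f_1(x) - f_1(x + 1) is elementary: integrating
B_3(t)/(x + t)^3 by parts over [0, 1] produces it (`stirlingDiff_eq_sub`). Gauss' product and
Stirling's formula for n! then show that f_1(x) is the sum of these differences at x + j, j ≥ 0
(`hasSum_stirlingDiff`).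

At the points x_n = (y + 2πin)/β the resulting double series over n and j converges absolutely, so n
may be summed first. Under the integral the sum over n is Lipschitz' formula ∑_n (y + 2πin)^{-3} =
Li_{-2}(e^{-y})/2. The same integrations by parts, now along y + tβ, yield Li_1(e^{-y}) + P(y) - P(y
+ β), where P is the `polylogSum` of order one (`hasSum_stirlingDiff_latticePoint`). Replacing y by
y + jβ and summing over j telescopes P, which tends to 0, and exp(-Li_1(e^{-y-jβ})) = 1 - e^{-y-jβ}
rebuilds the q-Pochhammer product (`hasSum_stirlingRemainder_one`).

The general y is reached by analytic continuation on the cut plane of direction ω. The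
polylogarithms of order 1 and 2 are continued by integrating along rays of direction ω. The factors
exp(-f_1) are continued instead of f_1, since 1/Γ is entire; their product converges locally
uniformly, and the identity theorem applies (`qPochhammerInf_eq_one`). Going from 1 to N adds
multiples of ∑_n x_n^{-(2k-1)} with k ≥ 2, which Lipschitz' formula again evaluates
(`hasSum_stirlingSum_sub`). -/

noncomputable section

open Filter Topology

/-! ### The difference f_1(x) - f_1(x + 1) and its decay. -/

/-- The Stirling main part of order one, `(x - 1/2) log x - x + (1/2) log (2π) + 1/(12x)`. -/
def stirlingMain (x : ℂ) : ℂ :=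
  (x - 1 / 2) * Complex.log x - x + (1 / 2) * (Real.log (2 * Real.pi) : ℂ) + stirlingSum 1 x

/-- The third Bernoulli polynomial. -/
def bernoulliCubic (t : ℂ) : ℂ := t ^ 3 - 3 / 2 * t ^ 2 + 1 / 2 * t

/-- `-(1/3) ∫_0^1 B_3(t) / (x + t)^3 dt`, the difference `f_1(x) - f_1(x + 1)`. -/
def stirlingDiff (x : ℂ) : ℂ :=
  -(1 / 3) * ∫ t in (0 : ℝ)..1, bernoulliCubic t / (x + t) ^ 3

lemma stirlingSum_one (x : ℂ) : stirlingSum 1 x = 1 / (12 * x) := by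
  simp only [stirlingSum, Finset.Icc_self, Finset.sum_singleton, mul_one, bernoulli_two]
  push_cast
  norm_num
  ring

lemma add_ofReal_mem_slitPlane {x : ℂ} (hx : x ∈ Complex.slitPlane) {t : ℝ} (ht : 0 ≤ t) :
    x + t ∈ Complex.slitPlane := by
  rw [Complex.mem_slitPlane_iff] at hx ⊢
  rcases hx with hx | hx
  · left; simp; linarith
  · right; simpa using hx

lemma mem_slitPlane_of_add_ofReal_ne_zero {x : ℂ} (hx : ∀ t : ℝ, 0 ≤ t → x + t ≠ 0) :
    x ∈ Complex.slitPlane := by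
  rw [Complex.mem_slitPlane_iff]
  by_contra! h
  refine hx (-x.re) (by linarith) ?_
  apply Complex.ext <;> simp [h.2]

/-- Three integrations by parts: B_3, B_2, B_1 are successive derivatives up to constants, while (x
+ t)^{-3} is integrated up to a logarithm. -/
lemma stirlingDiff_eq_sub {x : ℂ} (hx : x ∈ Complex.slitPlane) :
    stirlingDiff x = stirlingMain (x + 1) - stirlingMain x - Complex.log x := by
  have hne : ∀ t ∈ Set.uIcc (0 : ℝ) 1, x + (t : ℂ) ∈ Complex.slitPlane := fun t ht => by
    rw [Set.uIcc_of_le zero_le_one] at ht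
    exact add_ofReal_mem_slitPlane hx ht.1
  let G : ℂ → ℂ := fun t => -bernoulliCubic t / (2 * (x + t) ^ 2)
    - 3 / 2 * (t ^ 2 - t + 1 / 6) / (x + t) + 3 * (t - 1 / 2) * Complex.log (x + t)
    - 3 * ((x + t) * Complex.log (x + t) - (x + t))
  have hG : ∀ t ∈ Set.uIcc (0 : ℝ) 1,
      HasDerivAt (fun t : ℝ => G t) (bernoulliCubic t / (x + t) ^ 3) t := fun t ht => by
    refine HasDerivAt.comp_ofReal ?_
    have h1 := hne t ht
    have h0 := Complex.slitPlane_ne_zero h1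
    have du : HasDerivAt (fun s : ℂ => x + s) 1 (t : ℂ) := (hasDerivAt_id (t : ℂ)).const_add x
    have dl := du.clog h1
    have d1 : HasDerivAt bernoulliCubic (3 * (t : ℂ) ^ 2 - 3 * t + 1 / 2) (t : ℂ) := by
      have := (((hasDerivAt_pow 3 (t : ℂ))).sub ((hasDerivAt_pow 2 (t : ℂ)).const_mul (3 / 2))).add
        ((hasDerivAt_id (t : ℂ)).const_mul (1 / 2))
      refine this.congr_deriv ?_
      simp; ring
    have d2 : HasDerivAt (fun s : ℂ => s ^ 2 - s + 1 / 6) (2 * (t : ℂ) - 1) (t : ℂ) := by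
      have := ((hasDerivAt_pow 2 (t : ℂ)).sub (hasDerivAt_id (t : ℂ))).add_const (1 / 6)
      refine this.congr_deriv ?_
      simp
    have d3 : HasDerivAt (fun s : ℂ => 3 * (s - 1 / 2)) 3 (t : ℂ) :=
      (((hasDerivAt_id (t : ℂ)).sub_const (1 / 2)).const_mul 3).congr_deriv (by norm_num)
    have := (((d1.neg.div ((du.pow 2).const_mul 2) (by simpa using h0)).sub
      ((d2.const_mul (3 / 2)).div du h0)).add (d3.mul dl)).sub
      (((du.mul dl).sub du).const_mul 3)
    refine this.congr_deriv ?_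
    simp only [bernoulliCubic, Pi.pow_apply, Pi.neg_apply]
    field_simp
    ring
  have hint : IntervalIntegrable (fun t : ℝ => bernoulliCubic t / (x + t) ^ 3)
      MeasureTheory.volume 0 1 := by
    apply ContinuousOn.intervalIntegrable
    refine ContinuousOn.div (by unfold bernoulliCubic; fun_prop) (by fun_prop) fun t ht => ?_
    exact pow_ne_zero _ (Complex.slitPlane_ne_zero (hne t ht))
  rw [stirlingDiff, intervalIntegral.integral_eq_sub_of_hasDerivAt hG hint]
  have h0 := Complex.slitPlane_ne_zero hx
  have h1 : x + 1 ≠ 0 := by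
    simpa using Complex.slitPlane_ne_zero (hne 1 (by simp))
  simp only [G, stirlingMain, stirlingSum_one, bernoulliCubic]
  push_cast
  simp only [add_zero]
  field_simp
  ring

lemma norm_bernoulliCubic_le {t : ℝ} (h0 : 0 ≤ t) (h1 : t ≤ 1) : ‖bernoulliCubic t‖ ≤ 1 := by
  have : bernoulliCubic t = ((t ^ 3 - 3 / 2 * t ^ 2 + 1 / 2 * t : ℝ) : ℂ) := by
    simp [bernoulliCubic]
  rw [this, Complex.norm_real, Real.norm_eq_abs, abs_le]
  constructor <;> nlinarith [mul_nonneg h0 (sub_nonneg.2 h1), pow_nonneg h0 3, pow_nonneg h0 2,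
    mul_nonneg (pow_nonneg h0 2) (sub_nonneg.2 h1)]

/-- The hypothesis says that the ray x + [0, ∞) stays away from 0 at a linear rate. It is inherited
by x + j with r + j in place of r, so one constant K serves all shifts. -/
lemma norm_stirlingDiff_le {x : ℂ} {r K : ℝ} (hr : 0 < r)
    (hx : ∀ t : ℝ, 0 ≤ t → r + t ≤ K * ‖x + t‖) : ‖stirlingDiff x‖ ≤ K ^ 3 / r ^ 3 := by
  have hK : 0 < K := by
    by_contra! h
    have := hx 0 le_rfl
    nlinarith [norm_nonneg (x + (0 : ℝ))]
  have hb : ∀ t ∈ Set.uIoc (0 : ℝ) 1, ‖bernoulliCubic t / (x + t) ^ 3‖ ≤ K ^ 3 / r ^ 3 := by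
    intro t ht
    rw [Set.uIoc_of_le zero_le_one] at ht
    rw [norm_div, norm_pow]
    have h1 : r ≤ K * ‖x + t‖ := by linarith [hx t ht.1.le, ht.1]
    have h2 : r ^ 3 ≤ K ^ 3 * ‖x + t‖ ^ 3 := by
      rw [← mul_pow]; gcongr
    have h3 : 0 < ‖x + t‖ := by
      by_contra! h
      nlinarith
    rw [div_le_div_iff₀ (by positivity) (by positivity)]
    nlinarith [norm_bernoulliCubic_le ht.1.le ht.2, pow_pos hr 3]
  have := intervalIntegral.norm_integral_le_of_norm_le_const hb
  rw [stirlingDiff, norm_mul]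
  norm_num at this ⊢
  have h3 : 0 ≤ K ^ 3 / r ^ 3 := by positivity
  linarith

/-- The cubic decay is shared equally between the two variables: 3/2 > 1 leaves each factor
summable, which makes the double series over n and j absolutely convergent. -/
lemma inv_cube_le_rpow {r s : ℝ} (hr : 1 ≤ r) (hs : 0 ≤ s) :
    1 / (r + s) ^ 3 ≤ (r ^ (3 / 2 : ℝ))⁻¹ * ((1 + s) ^ (3 / 2 : ℝ))⁻¹ := by
  rw [← mul_inv, one_div]
  have h1 : r ^ (3 / 2 : ℝ) ≤ (r + s) ^ (3 / 2 : ℝ) :=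
    Real.rpow_le_rpow (by linarith) (by linarith) (by norm_num)
  have h2 : (1 + s) ^ (3 / 2 : ℝ) ≤ (r + s) ^ (3 / 2 : ℝ) :=
    Real.rpow_le_rpow (by linarith) (by linarith) (by norm_num)
  have h3 : (r + s) ^ 3 = (r + s) ^ (3 / 2 : ℝ) * (r + s) ^ (3 / 2 : ℝ) := by
    rw [← Real.rpow_add (by linarith), ← Real.rpow_natCast]
    norm_num
  have : 0 < r ^ (3 / 2 : ℝ) := Real.rpow_pos_of_pos (by linarith) _
  have : 0 < (1 + s) ^ (3 / 2 : ℝ) := Real.rpow_pos_of_pos (by linarith) _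
  rw [h3]
  gcongr

lemma summable_one_add_rpow_inv : Summable fun j : ℕ => ((1 + (j : ℝ)) ^ (3 / 2 : ℝ))⁻¹ := by
  have := (summable_nat_add_iff 1).2
    (Real.summable_nat_rpow_inv.2 (show (1 : ℝ) < 3 / 2 by norm_num))
  refine this.congr fun j => ?_
  push_cast
  rw [add_comm]

lemma summable_one_add_abs_rpow_inv :
    Summable fun n : ℤ => ((1 + |(n : ℝ)|) ^ (3 / 2 : ℝ))⁻¹ := by
  apply Summable.of_nat_of_neg <;> simpa using summable_one_add_rpow_inv

lemma norm_stirlingDiff_add_le {x : ℂ} {r K : ℝ} (hr : 1 ≤ r)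
    (hx : ∀ t : ℝ, 0 ≤ t → r + t ≤ K * ‖x + t‖) (j : ℕ) :
    ‖stirlingDiff (x + j)‖ ≤ K ^ 3 * ((r ^ (3 / 2 : ℝ))⁻¹ * ((1 + (j : ℝ)) ^ (3 / 2 : ℝ))⁻¹) := by
  have hK : 0 < K := by
    by_contra! h
    have := hx 0 le_rfl
    nlinarith [norm_nonneg (x + (0 : ℝ))]
  have hj : (0 : ℝ) ≤ j := by positivity
  have h := norm_stirlingDiff_le (x := x + j) (r := r + j) (K := K) (by linarith) fun t ht => by
    have := hx (j + t) (by positivity)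
    push_cast at this
    rw [add_assoc, add_assoc]
    exact this
  refine h.trans ?_
  rw [div_eq_mul_one_div]
  exact mul_le_mul_of_nonneg_left (inv_cube_le_rpow hr hj) (by positivity)

/-! ### Gauss' and Stirling's formulas, and f_1 as a series. -/

lemma summable_weierstrass (x : ℂ) :
    Summable fun m : ℕ => x / ((m + 1 : ℕ) : ℂ) - Complex.log (1 + x / ((m + 1 : ℕ) : ℂ)) := by
  have hs : Summable fun m : ℕ => ‖x‖ ^ 2 * (1 / ((m + 1 : ℕ) : ℝ) ^ 2) :=
    ((summable_nat_add_iff 1).2 (Real.summable_one_div_nat_pow.2 one_lt_two)).mul_left _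
  refine Summable.of_norm_bounded_eventually_nat hs ?_
  filter_upwards [eventually_ge_atTop (Nat.ceil (2 * ‖x‖))] with m hm
  have hm1 : 2 * ‖x‖ ≤ ((m + 1 : ℕ) : ℝ) := by
    have := (Nat.le_ceil (2 * ‖x‖)).trans (Nat.cast_le.2 hm)
    push_cast
    linarith
  have hpos : (0 : ℝ) < ((m + 1 : ℕ) : ℝ) := by positivity
  have hn : ‖x / ((m + 1 : ℕ) : ℂ)‖ = ‖x‖ / ((m + 1 : ℕ) : ℝ) := by
    rw [norm_div, Complex.norm_natCast]
  have hle : ‖x / ((m + 1 : ℕ) : ℂ)‖ ≤ 1 / 2 := by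
    rw [hn, div_le_iff₀ hpos]; linarith
  rw [norm_sub_rev]
  refine (Complex.norm_log_one_add_sub_self_le (by linarith)).trans ?_
  have h2 : (1 - ‖x / ((m + 1 : ℕ) : ℂ)‖)⁻¹ ≤ 2 := by
    rw [inv_le_comm₀ (by linarith) (by norm_num)]; linarith
  calc ‖x / ((m + 1 : ℕ) : ℂ)‖ ^ 2 * (1 - ‖x / ((m + 1 : ℕ) : ℂ)‖)⁻¹ / 2
      ≤ ‖x / ((m + 1 : ℕ) : ℂ)‖ ^ 2 * 2 / 2 := by gcongr
    _ = _ := by rw [hn]; ring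

lemma log_one_add_div {x : ℂ} (hx : x ∈ Complex.slitPlane) (m : ℕ) :
    Complex.log (1 + x / ((m + 1 : ℕ) : ℂ)) =
      Complex.log (x + (m + 1 : ℕ)) - Real.log ((m + 1 : ℕ) : ℝ) := by
  have hpos : (0 : ℝ) < ((m + 1 : ℕ) : ℝ) := by positivity
  have h1 : x + ((m + 1 : ℕ) : ℂ) ≠ 0 := by
    have := Complex.slitPlane_ne_zero (add_ofReal_mem_slitPlane hx hpos.le)
    simpa using this
  have h2 : ((m + 1 : ℕ) : ℂ) ≠ 0 := Nat.cast_ne_zero.2 (by omega)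
  have : 1 + x / ((m + 1 : ℕ) : ℂ) = (x + (m + 1 : ℕ)) * (((((m + 1 : ℕ) : ℝ)⁻¹ : ℝ)) : ℂ) := by
    push_cast at h2 ⊢
    field_simp
    ring
  rw [this, Complex.log_mul_ofReal _ (inv_pos.2 hpos) _ h1, Real.log_inv]
  push_cast
  ring

lemma sum_log_succ (n : ℕ) :
    ∑ m ∈ Finset.range n, Real.log ((m + 1 : ℕ) : ℝ) = Real.log (n.factorial : ℝ) := by
  induction n with
  | zero => simp
  | succ n ih =>
    rw [Finset.sum_range_succ, ih, Nat.factorial_succ, Nat.cast_mul, Real.log_mul, add_comm]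
    · exact Nat.cast_ne_zero.2 (by omega)
    · exact Nat.cast_ne_zero.2 n.factorial_ne_zero

/-- Gauss' product formula for `log Γ` on the slit plane. -/
lemma tendsto_logGamma {x : ℂ} (hx : x ∈ Complex.slitPlane) :
    Tendsto (fun n : ℕ => x * (Real.log n : ℂ) + (Real.log (n.factorial : ℝ) : ℂ) -
      ∑ j ∈ Finset.range (n + 1), Complex.log (x + j)) atTop (𝓝 (logGamma x)) := by
  have h1 := (summable_weierstrass x).hasSum.tendsto_sum_nat
  have h2 : Tendsto (fun n : ℕ => ((harmonic n - Real.log n : ℝ) : ℂ)) atTop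
      (𝓝 (Real.eulerMascheroniConstant : ℂ)) :=
    (Complex.continuous_ofReal.tendsto _).comp Real.tendsto_harmonic_sub_log
  have h3 := ((h2.neg.mul_const x).sub_const (Complex.log x)).add h1
  refine (h3.congr fun n => ?_)
  have hsum : ∑ m ∈ Finset.range n,
      (x / ((m + 1 : ℕ) : ℂ) - Complex.log (1 + x / ((m + 1 : ℕ) : ℂ))) =
      x * (harmonic n : ℂ) - ∑ m ∈ Finset.range n, Complex.log (x + (m + 1 : ℕ)) +
        (Real.log (n.factorial : ℝ) : ℂ) := by
    rw [← sum_log_succ, harmonic]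
    push_cast
    rw [Finset.mul_sum, ← Finset.sum_sub_distrib, ← Finset.sum_add_distrib]
    refine Finset.sum_congr rfl fun m _ => ?_
    have := log_one_add_div hx m
    push_cast at this
    rw [this]
    ring
  rw [hsum, Finset.sum_range_succ']
  push_cast
  simp only [add_zero]
  ring

lemma exp_logGamma {x : ℂ} (hx : x ∈ Complex.slitPlane) :
    Complex.exp (logGamma x) = Complex.Gamma x := by
  refine tendsto_nhds_unique ((Complex.continuous_exp.tendsto _).comp (tendsto_logGamma hx)) ?_
  refine (Complex.GammaSeq_tendsto_Gamma x).congr' ?_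
  filter_upwards [eventually_gt_atTop 0] with n hn
  have hn0 : (n : ℂ) ≠ 0 := Nat.cast_ne_zero.2 hn.ne'
  rw [Complex.GammaSeq, Function.comp_apply, Complex.exp_sub, Complex.exp_add, Complex.exp_sum]
  congr 1
  · rw [Complex.cpow_def_of_ne_zero hn0, ← Complex.ofReal_exp (Real.log _), Real.exp_log]
    · rw [mul_comm x, ← Complex.natCast_log]
      simp
    · exact_mod_cast n.factorial_pos
  · refine Finset.prod_congr rfl fun j _ => ?_
    rw [Complex.exp_log]
    have := Complex.slitPlane_ne_zero (add_ofReal_mem_slitPlane hx (Nat.cast_nonneg j))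
    simpa using this

lemma tendsto_natCast_mul_log (z : ℂ) :
    Tendsto (fun n : ℕ => (n : ℂ) * Complex.log (1 + z / n)) atTop (𝓝 z) := by
  exact Complex.tendsto_nat_mul_log_one_add_of_tendsto (tendsto_const_nhds.congr' (by
    filter_upwards [eventually_gt_atTop 0] with n hn
    have hn0 : (n : ℂ) ≠ 0 := Nat.cast_ne_zero.2 hn.ne'
    field_simp))

lemma tendsto_const_div_natCast (z : ℂ) : Tendsto (fun n : ℕ => z / (n : ℂ)) atTop (𝓝 0) := by
  have := (tendsto_inv_atTop_nhds_zero_nat (𝕜 := ℂ)).const_mul z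
  simpa [div_eq_mul_inv] using this

/-- Stirling's formula for `n!`, compared with the main part at `x + n + 1`. -/
lemma tendsto_log_factorial_sub_stirlingMain {x : ℂ} (hx : x ∈ Complex.slitPlane) :
    Tendsto (fun n : ℕ => x * (Real.log n : ℂ) + (Real.log (n.factorial : ℝ) : ℂ) -
      stirlingMain (x + (n + 1 : ℕ))) atTop (𝓝 0) := by
  have hS : Tendsto (fun n : ℕ => ((Real.log (Stirling.stirlingSeq n) : ℝ) : ℂ)) atTop
      (𝓝 (Real.log (Real.sqrt Real.pi) : ℂ)) := by
    refine (Complex.continuous_ofReal.tendsto _).comp ?_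
    exact (Real.continuousAt_log (by positivity)).tendsto.comp Stirling.tendsto_stirlingSeq_sqrt_pi
  have hL : Tendsto (fun n : ℕ => Complex.log (1 + (x + 1) / n)) atTop (𝓝 0) := by
    have h1 : Tendsto (fun n : ℕ => 1 + (x + 1) / (n : ℂ)) atTop (𝓝 (1 + 0)) :=
      (tendsto_const_div_natCast (x + 1)).const_add 1
    rw [add_zero] at h1
    have h2 := (continuousAt_clog (Complex.one_mem_slitPlane)).tendsto.comp h1
    rwa [Complex.log_one] at h2
  have hI : Tendsto (fun n : ℕ => 1 / (12 * (x + (n + 1 : ℕ)))) atTop (𝓝 (0 : ℂ)) := by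
    have h1 : Tendsto (fun n : ℕ => ‖x + (n + 1 : ℕ)‖) atTop atTop := by
      refine tendsto_atTop_mono (f := fun n : ℕ => (n : ℝ) - ‖x‖) (fun n => ?_)
        (tendsto_atTop_add_const_right _ _ tendsto_natCast_atTop_atTop)
      have := norm_sub_le (x + (n + 1 : ℕ)) x
      rw [add_sub_cancel_left, Complex.norm_natCast] at this
      push_cast at this ⊢
      linarith
    have h2 := (tendsto_inv₀_cobounded.comp (tendsto_norm_atTop_iff_cobounded.1 h1)).const_mul
      (1 / 12 : ℂ)
    rw [mul_zero] at h2
    refine h2.congr fun n => ?_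
    simp [mul_comm]
  have hT := (((hS.add_const ((1 / 2) * (Real.log 2 : ℂ) -
    (1 / 2) * (Real.log (2 * Real.pi) : ℂ))).sub (tendsto_natCast_mul_log (x + 1))).sub
    (hL.const_mul (x + 1 / 2))).add_const (x + 1) |>.sub hI
  -- The constant √π of `Stirling.stirlingSeq` and its factor √(2n) combine to √(2π), and the two
  -- occurrences of x + 1 cancel.
  have h0 : (Real.log (Real.sqrt Real.pi) : ℂ) + ((1 / 2) * (Real.log 2 : ℂ) -
      (1 / 2) * (Real.log (2 * Real.pi) : ℂ)) - (x + 1) - (x + 1 / 2) * 0 + (x + 1) - 0 = 0 := by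
    rw [Real.log_sqrt Real.pi_pos.le, Real.log_mul two_ne_zero Real.pi_ne_zero]
    push_cast
    ring
  rw [h0] at hT
  refine hT.congr' ?_
  filter_upwards [eventually_gt_atTop 0] with n hn
  have hnr : (0 : ℝ) < n := Nat.cast_pos.2 hn
  have hn0 : (n : ℂ) ≠ 0 := Nat.cast_ne_zero.2 hn.ne'
  have hxn : x + ((n + 1 : ℕ) : ℂ) ≠ 0 := by
    have := Complex.slitPlane_ne_zero (add_ofReal_mem_slitPlane hx (Nat.cast_nonneg (n + 1)))
    simpa using this
  have hlog : Complex.log (x + (n + 1 : ℕ)) = Real.log n + Complex.log (1 + (x + 1) / n) := by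
    have h : x + ((n + 1 : ℕ) : ℂ) = ((n : ℝ) : ℂ) * (1 + (x + 1) / n) := by
      push_cast
      field_simp
      ring
    have h' : 1 + (x + 1) / (n : ℂ) ≠ 0 := fun h0 => hxn (by rw [h, h0, mul_zero])
    rw [h, Complex.log_ofReal_mul hnr h']
  have hfac := Stirling.log_stirlingSeq_formula n
  rw [Real.log_div hnr.ne' (Real.exp_pos 1).ne', Real.log_exp,
    Real.log_mul two_ne_zero hnr.ne'] at hfac
  rw [stirlingMain, stirlingSum_one, hlog, hfac]
  push_cast
  ring

lemma sum_stirlingDiff {x : ℂ} (hx : x ∈ Complex.slitPlane) (n : ℕ) :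
    ∑ j ∈ Finset.range n, stirlingDiff (x + j) =
      stirlingMain (x + n) - stirlingMain x - ∑ j ∈ Finset.range n, Complex.log (x + j) := by
  induction n with
  | zero => simp
  | succ n ih =>
    have := add_ofReal_mem_slitPlane hx (Nat.cast_nonneg n)
    push_cast at this
    rw [Finset.sum_range_succ, Finset.sum_range_succ, ih, stirlingDiff_eq_sub this]
    push_cast
    rw [add_assoc]
    ring

lemma stirlingRemainder_one (x : ℂ) : stirlingRemainder 1 x = logGamma x - stirlingMain x := rfl

lemma mem_slitPlane_of_le_norm {x : ℂ} {r K : ℝ} (hr : 1 ≤ r)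
    (hx : ∀ t : ℝ, 0 ≤ t → r + t ≤ K * ‖x + t‖) : x ∈ Complex.slitPlane :=
  mem_slitPlane_of_add_ofReal_ne_zero fun t ht h => by
    have := hx t ht
    rw [h, norm_zero] at this
    linarith

/-- The first Stirling remainder as a sum of differences. -/
lemma hasSum_stirlingDiff {x : ℂ} {r K : ℝ} (hr : 1 ≤ r)
    (hx : ∀ t : ℝ, 0 ≤ t → r + t ≤ K * ‖x + t‖) :
    HasSum (fun j : ℕ => stirlingDiff (x + j)) (stirlingRemainder 1 x) := by
  have hs : Summable (fun j : ℕ => stirlingDiff (x + j)) :=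
    Summable.of_norm_bounded ((summable_one_add_rpow_inv.mul_left _).mul_left _)
      (norm_stirlingDiff_add_le hr hx)
  have hsl := mem_slitPlane_of_le_norm hr hx
  -- The shift by one matches Gauss' formula, whose n-th term contains the n + 1 logarithms of x,
  -- ..., x + n.
  refine hs.hasSum_iff_tendsto_nat.2 ((tendsto_add_atTop_iff_nat 1).1 ?_)
  have := ((tendsto_logGamma hsl).sub (tendsto_log_factorial_sub_stirlingMain hsl)).sub_const
    (stirlingMain x)
  rw [sub_zero] at this
  rw [stirlingRemainder_one]
  refine this.congr fun n => ?_
  rw [sum_stirlingDiff hsl]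
  ring

/-- The value of `∑_j (1 + j)^{-3/2}`. -/
def rpowSum : ℝ := ∑' j : ℕ, ((1 + (j : ℝ)) ^ (3 / 2 : ℝ))⁻¹

lemma norm_stirlingRemainder_one_le {x : ℂ} {r K : ℝ} (hr : 1 ≤ r)
    (hx : ∀ t : ℝ, 0 ≤ t → r + t ≤ K * ‖x + t‖) :
    ‖stirlingRemainder 1 x‖ ≤ K ^ 3 * rpowSum * (r ^ (3 / 2 : ℝ))⁻¹ := by
  have hs := (summable_one_add_rpow_inv.mul_left (r ^ (3 / 2 : ℝ))⁻¹).mul_left (K ^ 3)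
  rw [← (hasSum_stirlingDiff hr hx).tsum_eq]
  refine (tsum_of_norm_bounded hs.hasSum (norm_stirlingDiff_add_le hr hx)).trans_eq ?_
  rw [tsum_mul_left, tsum_mul_left, rpowSum]
  ring

/-! ### Lower bounds along the rays from the lattice points. -/

lemma latticePoint_add {β : ℂ} (hβ : 0 < β.re) (y : ℂ) (n : ℤ) (s : ℂ) :
    latticePoint β y n + s = (y + (2 * Real.pi * Complex.I * n + β * s)) / β := by
  have hβ0 : β ≠ 0 := fun h => by simp [h] at hβ
  rw [latticePoint]
  field_simp
  ring

lemma eventually_le_abs_intCast (M : ℝ) : ∀ᶠ n : ℤ in cofinite, M ≤ |(n : ℝ)| :=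
  (tendsto_norm_comp_cofinite_atTop_of_isClosedEmbedding
    Int.isClosedEmbedding_coe_real).eventually_ge_atTop M

lemma two_pi_I_re (n : ℤ) : (2 * Real.pi * Complex.I * n : ℂ).re = 0 := by
  simp

lemma two_pi_I_im (n : ℤ) : (2 * Real.pi * Complex.I * n : ℂ).im = 2 * Real.pi * n := by
  simp

/-- Since Re β > 0, the directions i and β are linearly independent over ℝ: the real part controls
t, and then the imaginary part controls n. -/
lemma abs_add_le_norm_ray {β : ℂ} (hβ : 0 < β.re) : ∃ C : ℝ, 0 < C ∧ ∀ (n : ℤ) (t : ℝ), 0 ≤ t →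
    |(n : ℝ)| + t ≤ C * ‖2 * Real.pi * Complex.I * n + β * t‖ := by
  refine ⟨1 + ‖β‖ / β.re + 1 / β.re, by positivity, fun n t ht => ?_⟩
  set w : ℂ := 2 * Real.pi * Complex.I * n + β * t with hw
  have hre : w.re = β.re * t := by simp [hw]
  have him : w.im = 2 * Real.pi * n + β.im * t := by simp [hw]
  have h1 : t ≤ ‖w‖ / β.re := by
    rw [le_div_iff₀ hβ]
    have := Complex.re_le_norm w
    rw [hre] at this
    linarith
  have h2 : |(n : ℝ)| ≤ ‖w‖ + ‖β‖ * t := by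
    have h3 : |2 * Real.pi * n| ≤ ‖w‖ + ‖β‖ * t := by
      have : 2 * Real.pi * n = w.im - β.im * t := by rw [him]; ring
      rw [this]
      refine (abs_sub _ _).trans ?_
      rw [abs_mul, abs_of_nonneg ht]
      gcongr
      · exact Complex.abs_im_le_norm w
      · exact Complex.abs_im_le_norm β
    rw [abs_mul, abs_of_pos Real.two_pi_pos] at h3
    nlinarith [abs_nonneg (n : ℝ), Real.pi_gt_three]
  calc |(n : ℝ)| + t ≤ ‖w‖ + ‖β‖ * (‖w‖ / β.re) + ‖w‖ / β.re := by gcongr; exact h2.trans (by gcongr)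
    _ = _ := by ring

/-- In the half-plane Re y > 0 no ray comes within Re y of the origin before division by β, so all n
are covered. This is what the double series needs. -/
lemma exists_le_norm_latticePoint_add {β y : ℂ} (hβ : 0 < β.re) (hy : 0 < y.re) :
    ∃ K : ℝ, ∀ (n : ℤ) (t : ℝ), 0 ≤ t →
      1 + |(n : ℝ)| + t ≤ K * ‖latticePoint β y n + t‖ := by
  obtain ⟨C, hC, h⟩ := abs_add_le_norm_ray hβ
  have hβ0 : 0 < ‖β‖ := norm_pos_iff.2 fun h => by simp [h] at hβ
  refine ⟨(1 / y.re + C * (1 + ‖y‖ / y.re)) * ‖β‖, fun n t ht => ?_⟩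
  rw [latticePoint_add hβ, norm_div]
  set w : ℂ := 2 * Real.pi * Complex.I * n + β * t with hw
  have h1 : y.re ≤ ‖y + w‖ := by
    refine le_trans ?_ (Complex.re_le_norm _)
    have : (y + w).re = y.re + β.re * t := by simp [hw]
    rw [this]
    have := mul_nonneg hβ.le ht
    linarith
  have h2 : ‖w‖ ≤ ‖y + w‖ + ‖y‖ := by
    have := norm_sub_le (y + w) y
    rwa [add_sub_cancel_left] at this
  have h3 : 1 ≤ ‖y + w‖ / y.re := by rwa [le_div_iff₀ hy, one_mul]
  have h4 : ‖y‖ ≤ ‖y‖ * (‖y + w‖ / y.re) := le_mul_of_one_le_right (norm_nonneg _) h3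
  calc 1 + |(n : ℝ)| + t = 1 + (|(n : ℝ)| + t) := by ring
    _ ≤ ‖y + w‖ / y.re + C * (‖y + w‖ + ‖y‖ * (‖y + w‖ / y.re)) := by
        gcongr
        exact (h n t ht).trans (by gcongr; linarith)
    _ = _ := by field_simp

/-- For bounded y without a sign condition on Re y, finitely many n must be given up. The gain is
uniformity in y, needed for locally uniform convergence. -/
lemma exists_le_norm_latticePoint_add_of_norm_le {β : ℂ} (hβ : 0 < β.re) (R : ℝ) :
    ∃ K M : ℝ, ∀ y : ℂ, ‖y‖ ≤ R → ∀ n : ℤ, M ≤ |(n : ℝ)| → ∀ t : ℝ, 0 ≤ t →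
      1 + |(n : ℝ)| + t ≤ K * ‖latticePoint β y n + t‖ := by
  obtain ⟨C, hC, h⟩ := abs_add_le_norm_ray hβ
  have hβ0 : 0 < ‖β‖ := norm_pos_iff.2 fun h => by simp [h] at hβ
  -- For |n| ≥ 2CR the shift by y costs at most half of |n|, and |n| ≥ 1 absorbs the summand 1; each
  -- costs a factor 2.
  refine ⟨4 * C * ‖β‖, max 1 (2 * C * R), fun y hy n hn t ht => ?_⟩
  rw [latticePoint_add hβ, norm_div]
  set w : ℂ := 2 * Real.pi * Complex.I * n + β * t with hw
  have h2 : ‖w‖ ≤ ‖y + w‖ + ‖y‖ := by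
    have := norm_sub_le (y + w) y
    rwa [add_sub_cancel_left] at this
  have h3 := h n t ht
  have h4 := le_max_left 1 (2 * C * R)
  have h5 := le_max_right 1 (2 * C * R)
  have h6 : C * ‖w‖ ≤ C * ‖y + w‖ + C * R := by nlinarith
  have h7 : 4 * C * ‖β‖ * (‖y + w‖ / ‖β‖) = 4 * (C * ‖y + w‖) := by field_simp
  rw [h7]
  linarith

/-! ### Geometry of the cut plane. -/

lemma mem_cutPlane_iff {ω : ℂ} (hω : 0 < ω.re) {y : ℂ} :
    y ∈ cutPlane ω ↔ ∀ n : ℤ, (y + 2 * Real.pi * Complex.I * n) / ω ∈ Complex.slitPlane := by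
  have hω0 : ω ≠ 0 := fun h => by simp [h] at hω
  constructor
  · intro h n
    refine mem_slitPlane_of_add_ofReal_ne_zero fun t ht h0 => h (-n) t ht ?_
    field_simp at h0
    push_cast
    linear_combination h0
  · intro h n t ht h0
    have := Complex.slitPlane_ne_zero (add_ofReal_mem_slitPlane (h (-n)) ht)
    apply this
    rw [h0]
    field_simp
    push_cast
    ring

lemma add_mul_mem_cutPlane {ω y : ℂ} (hy : y ∈ cutPlane ω) {s : ℝ} (hs : 0 ≤ s) :
    y + s * ω ∈ cutPlane ω := fun n t ht h => by
  refine hy n (t + s) (by linarith) ?_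
  push_cast
  linear_combination h

lemma mem_cutPlane_of_re_pos {ω y : ℂ} (hω : 0 < ω.re) (hy : 0 < y.re) : y ∈ cutPlane ω := by
  intro n t ht h
  have := congrArg Complex.re h
  rw [Complex.sub_re, two_pi_I_re, Complex.re_ofReal_mul] at this
  nlinarith [mul_nonneg ht hω.le]

lemma add_ne_zero_of_mem_cutPlane {ω y : ℂ} (hy : y ∈ cutPlane ω) (n : ℤ) :
    y + 2 * Real.pi * Complex.I * n ≠ 0 := fun h => by
  refine hy (-n) 0 le_rfl ?_
  push_cast
  linear_combination h

lemma isOpen_cutPlane {ω : ℂ} (hω : 0 < ω.re) : IsOpen (cutPlane ω) := by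
  -- These are the real coordinates y = 2πi A - T ω. The removed rays are T ≥ 0, A ∈ ℤ, a closed
  -- condition.
  let T : ℂ → ℝ := fun y => -y.re / ω.re
  let A : ℂ → ℝ := fun y => (y.im + T y * ω.im) / (2 * Real.pi)
  have hT : Continuous T := by fun_prop
  have hA : Continuous A := by fun_prop
  have : (cutPlane ω)ᶜ = {y | 0 ≤ T y} ∩ A ⁻¹' Set.range ((↑) : ℤ → ℝ) := by
    ext y
    simp only [cutPlane, Set.mem_compl_iff, Set.mem_ofPred_eq, not_forall, not_not, Set.mem_inter_iff,
      Set.mem_preimage, Set.mem_range]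
    constructor
    · rintro ⟨n, t, ht, h⟩
      have hre := congrArg Complex.re h
      have him := congrArg Complex.im h
      rw [Complex.sub_re, two_pi_I_re, Complex.re_ofReal_mul] at hre
      rw [Complex.sub_im, two_pi_I_im, Complex.im_ofReal_mul] at him
      have hTt : T y = t := by
        simp only [T, hre]
        field_simp
        ring
      refine ⟨hTt ▸ ht, n, ?_⟩
      simp only [A, hTt, him]
      field_simp
      ring
    · rintro ⟨hT0, n, hn⟩
      refine ⟨n, T y, hT0, ?_⟩
      have hpi := Real.pi_ne_zero
      apply Complex.ext
      · rw [Complex.sub_re, two_pi_I_re, Complex.re_ofReal_mul]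
        simp only [T]
        field_simp
        ring
      · rw [Complex.sub_im, two_pi_I_im, Complex.im_ofReal_mul, hn]
        simp only [A]
        field_simp
        ring
  rw [← isClosed_compl_iff, this]
  exact (isClosed_le continuous_const hT).inter
    (Int.isClosedEmbedding_coe_real.isClosed_range.preimage hA)

lemma exists_re_add_mul_pos {ω : ℂ} (hω : 0 < ω.re) (y : ℂ) :
    0 < (y + ((‖y‖ + 1) / ω.re : ℝ) * ω).re := by
  rw [Complex.add_re, Complex.re_ofReal_mul, div_mul_cancel₀ _ hω.ne']
  linarith [(abs_le.1 (Complex.abs_re_le_norm y)).1]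

/-- Moving in the direction ω never meets a cut and ends in the half-plane Re y > 0, which is
convex. -/
lemma isPreconnected_cutPlane {ω : ℂ} (hω : 0 < ω.re) : IsPreconnected (cutPlane ω) := by
  refine isPreconnected_of_forall 1 fun y hy => ?_
  refine ⟨{z | 0 < z.re} ∪ (fun s : ℝ => y + s * ω) '' Set.Ici 0, ?_, ?_, ?_, ?_⟩
  · rintro z (hz | ⟨s, hs, rfl⟩)
    · exact mem_cutPlane_of_re_pos hω hz
    · exact add_mul_mem_cutPlane hy hs
  · left; simp
  · right; exact ⟨0, by simp⟩
  · refine IsPreconnected.union (y + ((‖y‖ + 1) / ω.re : ℝ) * ω) (exists_re_add_mul_pos hω y)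
      ⟨_, ?_, rfl⟩ (convex_halfSpace_re_gt 0).isPreconnected
      (isPreconnected_Ici.image _ (by fun_prop))
    exact Set.mem_Ici.2 (by positivity)

lemma exists_mem_cutPlane {y : ℂ} (hy : ∀ n : ℤ, y ≠ 2 * Real.pi * Complex.I * n) :
    ∃ ω : ℂ, 0 < ω.re ∧ y ∈ cutPlane ω := by
  by_cases h : ∃ n : ℤ, y.im = 2 * Real.pi * n
  · obtain ⟨m, hm⟩ := h
    rcases lt_or_ge 0 y.re with hr | hr
    · exact ⟨1, by simp, mem_cutPlane_of_re_pos (by simp) hr⟩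
    · have hr0 : y.re < 0 := by
        refine lt_of_le_of_ne hr fun h0 => hy m ?_
        apply Complex.ext
        · rw [two_pi_I_re, h0]
        · rw [two_pi_I_im, hm]
      -- The slope is chosen so that, at the abscissa Re y, the cuts have heights 2πn - π, halfway
      -- between the multiples of 2π.
      refine ⟨⟨1, Real.pi / -y.re⟩, by simp, fun n t _ h => ?_⟩
      have hre := congrArg Complex.re h
      have him := congrArg Complex.im h
      rw [Complex.sub_re, two_pi_I_re, Complex.re_ofReal_mul] at hre
      rw [Complex.sub_im, two_pi_I_im, Complex.im_ofReal_mul, hm] at him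
      have ht : t = -y.re := by simp only at hre; linarith
      simp only [ht] at him
      rw [mul_div_cancel₀ _ (by linarith)] at him
      have hpi := Real.pi_pos
      have h2 : (2 * m : ℝ) = 2 * n - 1 := by
        apply mul_left_cancel₀ hpi.ne'
        linarith
      have h3 : 2 * m = 2 * n - 1 := by exact_mod_cast h2
      omega
  · refine ⟨1, by simp, fun n t _ h0 => h ⟨n, ?_⟩⟩
    have him := congrArg Complex.im h0
    rw [Complex.sub_im, two_pi_I_im] at him
    simpa using him

/-! ### Branches of the logarithm at the lattice points. -/

lemma log_add_log_of_im_pos {a b : ℂ} (ha : 0 < a.im) (hb : b ≠ 0) (hab : 0 < (a * b).im)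
    (hb' : b.arg < Real.pi) : Complex.log a + Complex.log b = Complex.log (a * b) := by
  have ha0 : a ≠ 0 := fun h => by simp [h] at ha
  have h1 : 0 < a.arg := by
    refine lt_of_le_of_ne (Complex.arg_nonneg_iff.2 ha.le) fun h => ?_
    rw [eq_comm, Complex.arg_eq_zero_iff] at h
    linarith [h.2]
  have h2 : a.arg ≤ Real.pi := Complex.arg_le_pi a
  have h3 := Complex.neg_pi_lt_arg b
  refine (Complex.log_mul ha0 hb ⟨by linarith, ?_⟩).symm
  -- If the arguments added up to more than π, their sum would lie in (π, 2π), where the sine is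
  -- negative, contradicting Im(ab) > 0.
  by_contra! h
  have h4 : (a * b).im = ‖a‖ * ‖b‖ * Real.sin (a.arg + b.arg) := by
    rw [← Complex.norm_mul_exp_arg_mul_I (a * b)]
    conv_lhs => rw [Complex.norm_mul_exp_arg_mul_I, ← Complex.norm_mul_exp_arg_mul_I a,
      ← Complex.norm_mul_exp_arg_mul_I b]
    rw [mul_mul_mul_comm, ← Complex.exp_add, ← Complex.ofReal_mul, Complex.im_ofReal_mul, ← add_mul,
      ← Complex.ofReal_add, Complex.exp_ofReal_mul_I_im]
  have h5 : Real.sin (a.arg + b.arg) < 0 := by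
    rw [← Real.sin_sub_two_pi]
    exact Real.sin_neg_of_neg_of_neg_pi_lt (by linarith) (by linarith)
  have : 0 < ‖a‖ * ‖b‖ := mul_pos (norm_pos_iff.2 ha0) (norm_pos_iff.2 hb)
  nlinarith

/-- Complex conjugation reduces this to the upper half-plane. -/
lemma log_add_log_of_im_neg {a b : ℂ} (ha : a.im < 0) (hb : b ∈ Complex.slitPlane)
    (hab : (a * b).im < 0) : Complex.log a + Complex.log b = Complex.log (a * b) := by
  have hb0 := Complex.slitPlane_ne_zero hb
  have hbp := Complex.slitPlane_arg_ne_pi hb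
  have h1 : a.arg ≠ Real.pi := fun h => by
    rw [Complex.arg_eq_pi_iff] at h
    linarith [h.2]
  have h2 : (a * b).arg ≠ Real.pi := fun h => by
    rw [Complex.arg_eq_pi_iff] at h
    linarith [h.2]
  have h := log_add_log_of_im_pos (a := (starRingEnd ℂ) a) (b := (starRingEnd ℂ) b)
    (by simpa using ha) (by simpa using hb0)
    (by rw [← map_mul, Complex.conj_im]; linarith)
    (by rw [Complex.arg_conj, if_neg hbp]; linarith [Complex.neg_pi_lt_arg b])
  rw [← map_mul, Complex.log_conj _ h1, Complex.log_conj _ hbp, Complex.log_conj _ h2,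
    ← map_add] at h
  exact (starRingEnd ℂ).injective h

lemma div_mem_slitPlane {ω β : ℂ} (hω : 0 < ω.re) (hβ : 0 < β.re) :
    ω / β ∈ Complex.slitPlane := by
  have hβ0 : β ≠ 0 := fun h => by simp [h] at hβ
  refine mem_slitPlane_of_add_ofReal_ne_zero fun t ht h => ?_
  have h : ω + t * β = 0 := by
    field_simp at h
    linear_combination h
  have := congrArg Complex.re h
  rw [Complex.add_re, Complex.re_ofReal_mul, Complex.zero_re] at this
  nlinarith [mul_nonneg ht hβ.le]

lemma log_div_of_re_pos {z w : ℂ} (hz : 0 < z.re) (hw : 0 < w.re) :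
    Complex.log (z / w) = Complex.log z - Complex.log w := by
  have hz0 : z ≠ 0 := fun h => by simp [h] at hz
  have hw0 : w ≠ 0 := fun h => by simp [h] at hw
  have h1 := abs_lt.1 (Complex.abs_arg_lt_pi_div_two_iff.2 (Or.inl hz))
  have h2 := abs_lt.1 (Complex.abs_arg_lt_pi_div_two_iff.2 (Or.inl hw))
  have h3 : w.arg ≠ Real.pi := by linarith [Real.pi_pos]
  rw [div_eq_mul_inv, Complex.log_mul hz0 (inv_ne_zero hw0), Complex.log_inv _ h3, sub_eq_add_neg]
  rw [Complex.arg_inv, if_neg h3]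
  constructor <;> linarith

lemma add_two_pi_re (y : ℂ) (n : ℤ) : (y + 2 * Real.pi * Complex.I * n).re = y.re := by
  rw [Complex.add_re, two_pi_I_re, add_zero]

lemma latticeLog_of_re_pos {ω β y : ℂ} (hω : 0 < ω.re) (hβ : 0 < β.re) (hy : 0 < y.re) (n : ℤ) :
    latticeLog ω β y n = Complex.log (latticePoint β y n) := by
  have hz : 0 < (y + 2 * Real.pi * Complex.I * n).re := by rwa [add_two_pi_re]
  rw [latticeLog, latticePoint, log_div_of_re_pos hz hω, log_div_of_re_pos hω hβ,
    log_div_of_re_pos hz hβ]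
  ring

lemma exists_im_div_pos {ω : ℂ} (hω : 0 < ω.re) (R : ℝ) :
    ∃ M : ℝ, ∀ y : ℂ, ‖y‖ ≤ R → ∀ n : ℤ, M ≤ |(n : ℝ)| →
      (0 < n → 0 < ((y + 2 * Real.pi * Complex.I * n) / ω).im) ∧
      (n ≤ 0 → ((y + 2 * Real.pi * Complex.I * n) / ω).im < 0) := by
  have hω0 : ω ≠ 0 := fun h => by simp [h] at hω
  have hc : 0 < (ω⁻¹).re := by
    rw [Complex.inv_re]
    exact div_pos hω (Complex.normSq_pos.2 hω0)
  refine ⟨(R * ‖ω⁻¹‖ + 1) / (2 * Real.pi * (ω⁻¹).re), fun y hy n hn => ?_⟩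
  have h1 : ((y + 2 * Real.pi * Complex.I * n) / ω).im =
      (y * ω⁻¹).im + 2 * Real.pi * (ω⁻¹).re * n := by
    rw [div_eq_mul_inv, add_mul, Complex.add_im]
    congr 1
    rw [Complex.mul_im, two_pi_I_re, two_pi_I_im]
    ring
  have h2 : |(y * ω⁻¹).im| ≤ R * ‖ω⁻¹‖ := by
    refine (Complex.abs_im_le_norm _).trans ?_
    rw [norm_mul]
    gcongr
  have h3 := abs_le.1 h2
  have hp : 0 < 2 * Real.pi * (ω⁻¹).re := by positivity
  rw [div_le_iff₀ hp] at hn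
  rw [h1]
  constructor
  · intro h0
    rw [abs_of_pos (by exact_mod_cast h0)] at hn
    linarith [h3.1]
  · intro h0
    rw [abs_of_nonpos (by exact_mod_cast h0)] at hn
    linarith [h3.2]

/-- For large |n| the quotients of y + 2πin by ω and by β lie in the same open half-plane, upper or
lower according to the sign of n. Hence the continued logarithm is principal for all but finitely
many n, uniformly for bounded y. -/
lemma exists_latticeLog_eq_log {ω β : ℂ} (hω : 0 < ω.re) (hβ : 0 < β.re) (R : ℝ) :
    ∃ M : ℝ, ∀ y : ℂ, ‖y‖ ≤ R → ∀ n : ℤ, M ≤ |(n : ℝ)| →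
      latticeLog ω β y n = Complex.log (latticePoint β y n) := by
  have hω0 : ω ≠ 0 := fun h => by simp [h] at hω
  obtain ⟨M₁, h₁⟩ := exists_im_div_pos hω R
  obtain ⟨M₂, h₂⟩ := exists_im_div_pos hβ R
  refine ⟨max M₁ M₂, fun y hy n hn => ?_⟩
  have h1 := h₁ y hy n ((le_max_left _ _).trans hn)
  have h2 := h₂ y hy n ((le_max_right _ _).trans hn)
  have hb := div_mem_slitPlane hω hβ
  have hmul : (y + 2 * Real.pi * Complex.I * n) / ω * (ω / β) = latticePoint β y n :=
    div_mul_div_cancel₀ hω0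
  rw [latticeLog]
  rcases lt_or_ge 0 n with h0 | h0
  · have := log_add_log_of_im_pos (h1.1 h0) (Complex.slitPlane_ne_zero hb)
      (by rw [hmul]; exact h2.1 h0)
      (lt_of_le_of_ne (Complex.arg_le_pi _) (Complex.slitPlane_arg_ne_pi hb))
    rw [this, hmul]
  · have := log_add_log_of_im_neg (h1.2 h0) hb (by rw [hmul]; exact h2.2 h0)
    rw [this, hmul]

/-! ### Lattice sums and Lipschitz' formula. -/

/-- The sums `∑_n (y + 2πin)^{-m}`. -/
def latticeSum (m : ℕ) (y : ℂ) : ℂ := ∑' n : ℤ, 1 / (y + 2 * Real.pi * Complex.I * n) ^ m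

lemma latticePoint_one (y : ℂ) (n : ℤ) :
    latticePoint 1 y n = y + 2 * Real.pi * Complex.I * n := div_one _

lemma inv_pow_le_rpow {r a K : ℝ} (hr : 1 ≤ r) (h : r ≤ K * a) (ha : 0 ≤ a) {m : ℕ} (hm : 2 ≤ m) :
    1 / a ^ m ≤ K ^ m * (r ^ (3 / 2 : ℝ))⁻¹ := by
  have hr0 : 0 < r := by linarith
  have h1 : r ^ (3 / 2 : ℝ) ≤ r ^ m := by
    rw [← Real.rpow_natCast]
    refine Real.rpow_le_rpow_of_exponent_le hr ?_
    have : (2 : ℝ) ≤ m := by exact_mod_cast hm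
    linarith
  have h2 : r ^ m ≤ K ^ m * a ^ m := by
    rw [← mul_pow]; gcongr
  have ha0 : 0 < a := by
    by_contra! h0
    have : a = 0 := le_antisymm h0 ha
    rw [this] at h
    linarith
  have h3 : 0 < r ^ (3 / 2 : ℝ) := Real.rpow_pos_of_pos hr0 _
  rw [← div_eq_mul_inv, div_le_div_iff₀ (pow_pos ha0 m) h3, one_mul]
  exact h1.trans h2

lemma exists_norm_inv_pow_le {m : ℕ} (hm : 2 ≤ m) (R : ℝ) :
    ∃ K M : ℝ, ∀ y : ℂ, ‖y‖ ≤ R → ∀ n : ℤ, M ≤ |(n : ℝ)| →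
      ‖1 / (y + 2 * Real.pi * Complex.I * n) ^ m‖ ≤
        K ^ m * ((1 + |(n : ℝ)|) ^ (3 / 2 : ℝ))⁻¹ := by
  obtain ⟨K, M, h⟩ := exists_le_norm_latticePoint_add_of_norm_le (β := 1) (by simp) R
  refine ⟨K, M, fun y hy n hn => ?_⟩
  have h1 := h y hy n hn 0 le_rfl
  rw [latticePoint_one, Complex.ofReal_zero, add_zero, add_zero] at h1
  rw [norm_div, norm_one, norm_pow]
  exact inv_pow_le_rpow (by linarith [abs_nonneg (n : ℝ)]) h1 (norm_nonneg _) hm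

lemma summable_latticeSum {m : ℕ} (hm : 2 ≤ m) (y : ℂ) :
    Summable fun n : ℤ => 1 / (y + 2 * Real.pi * Complex.I * n) ^ m := by
  obtain ⟨K, M, h⟩ := exists_norm_inv_pow_le hm ‖y‖
  refine Summable.of_norm_bounded_eventually (summable_one_add_abs_rpow_inv.mul_left (K ^ m)) ?_
  filter_upwards [eventually_le_abs_intCast M] with n hn using h y le_rfl n hn

lemma analyticOnNhd_latticeSum {ω : ℂ} (hω : 0 < ω.re) {m : ℕ} (hm : 2 ≤ m) :
    AnalyticOnNhd ℂ (latticeSum m) (cutPlane ω) := by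
  refine DifferentiableOn.analyticOnNhd ?_ (isOpen_cutPlane hω)
  refine SummableLocallyUniformlyOn.differentiableOn (isOpen_cutPlane hω)
    (SummableLocallyUniformlyOn.of_locally_bounded_eventually (isOpen_cutPlane hω)
      fun S _ hS => ?_) fun n y hy => ?_
  · obtain ⟨R, hR⟩ := hS.isBounded.exists_norm_le
    obtain ⟨K, M, h⟩ := exists_norm_inv_pow_le hm R
    refine ⟨_, summable_one_add_abs_rpow_inv.mul_left (K ^ m), ?_⟩
    filter_upwards [eventually_le_abs_intCast M] with n hn y hy using h y (hR y hy) n hn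
  · have := pow_ne_zero m (add_ne_zero_of_mem_cutPlane hy n)
    fun_prop (disch := assumption)

/-- Lipschitz' formula. -/
lemma latticeSum_of_re_pos {k : ℕ} (hk : 1 ≤ k) {y : ℂ} (hy : 0 < y.re) :
    (k.factorial : ℂ) * latticeSum (k + 1) y = polylogSeries (-(k : ℤ)) (Complex.exp (-y)) := by
  have hpi : (Real.pi : ℂ) ≠ 0 := Complex.ofReal_ne_zero.2 Real.pi_ne_zero
  have hI := Complex.I_ne_zero
  -- With this τ the nome e^{2πiτ} is e^{-y}, and Im τ > 0 is exactly Re y > 0.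
  let τ : UpperHalfPlane := ⟨Complex.I * y / (2 * Real.pi), by
    have : Complex.I * y / (2 * Real.pi) = Complex.I * y / ((2 * Real.pi : ℝ) : ℂ) := by
      push_cast; rfl
    rw [this, Complex.div_ofReal_im, Complex.I_mul_im]
    positivity⟩
  have hτ : (τ : ℂ) = Complex.I * y / (2 * Real.pi) := rfl
  have h := EisensteinSeries.qExpansion_identity hk τ
  have hz : 2 * Real.pi * Complex.I * (τ : ℂ) = -y := by
    rw [hτ]
    field_simp
    rw [Complex.I_sq]
    ring
  rw [hz] at h
  have hfac : (k.factorial : ℂ) ≠ 0 := Nat.cast_ne_zero.2 k.factorial_ne_zero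
  have hne : (-2 * (Real.pi : ℂ) * Complex.I) ^ (k + 1) ≠ 0 := by
    apply pow_ne_zero
    simp [hpi]
  have hsum : latticeSum (k + 1) y =
      ((-2 * (Real.pi : ℂ) * Complex.I) ^ (k + 1))⁻¹ * ∑' n : ℤ, 1 / ((τ : ℂ) + n) ^ (k + 1) := by
    -- The sign of n is reversed because y + 2πin = -2πi(τ - n).
    rw [latticeSum, ← (Equiv.neg ℤ).tsum_eq, ← tsum_mul_left]
    refine tsum_congr fun n => ?_
    rw [one_div, one_div, ← mul_inv, ← mul_pow]
    congr 2
    simp only [Equiv.neg_apply]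
    push_cast
    linear_combination hz
  rw [hsum, h, polylogSeries]
  have hser : ∑' n : ℕ, (n : ℂ) ^ k * Complex.exp (-y) ^ n =
      ∑' j : ℕ, Complex.exp (-y) ^ (j + 1) / ((j + 1 : ℕ) : ℂ) ^ (-(k : ℤ)) := by
    rw [← Function.Injective.tsum_eq (g := fun j : ℕ => j + 1) (add_left_injective 1)]
    · refine tsum_congr fun j => ?_
      rw [zpow_neg, zpow_natCast, div_inv_eq_mul, mul_comm]
    · intro n hn
      rcases n with _ | n
      · simp [show k ≠ 0 by omega] at hn
      · exact ⟨n, rfl⟩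
  rw [← hser]
  field_simp

/-! ### Primitives on the cut plane by integration along rays. -/

lemma continuous_add_ofReal_mul (y ω : ℂ) : Continuous fun s : ℝ => y + s * ω := by fun_prop

lemma hasDerivAt_add_ofReal_mul (y ω : ℂ) (s : ℝ) :
    HasDerivAt (fun s : ℝ => y + s * ω) ω s := by
  simpa using ((Complex.ofRealCLM.hasDerivAt (x := s)).mul_const ω).const_add y

/-- The primitive of `-g` obtained by extending `F₀` from the half-plane along the direction `ω`. -/
def primitiveExtension (ω : ℂ) (F₀ g : ℂ → ℂ) (T : ℝ) (y : ℂ) : ℂ :=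
  F₀ (y + T * ω) + ω * ∫ s in (0 : ℝ)..T, g (y + s * ω)

lemma uIcc_nonneg {a b s : ℝ} (ha : 0 ≤ a) (hb : 0 ≤ b) (hs : s ∈ Set.uIcc a b) : 0 ≤ s :=
  (le_min ha hb).trans hs.1

lemma intervalIntegrable_ray {ω : ℂ} {g : ℂ → ℂ} (hg : ContinuousOn g (cutPlane ω)) {y : ℂ}
    (hy : y ∈ cutPlane ω) {a b : ℝ} (ha : 0 ≤ a) (hb : 0 ≤ b) :
    IntervalIntegrable (fun s : ℝ => g (y + s * ω)) MeasureTheory.volume a b := by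
  apply ContinuousOn.intervalIntegrable
  exact hg.comp (continuous_add_ofReal_mul y ω).continuousOn fun s hs =>
    add_mul_mem_cutPlane hy (uIcc_nonneg ha hb hs)

/-- Between two endpoints in the half-plane, the change of F₀ is compensated by the integral of its
derivative -g. -/
lemma primitiveExtension_congr {ω : ℂ} (hω : 0 < ω.re) {F₀ g : ℂ → ℂ}
    (hg : ContinuousOn g (cutPlane ω)) (hF : ∀ y : ℂ, 0 < y.re → HasDerivAt F₀ (-g y) y) {y : ℂ}
    (hy : y ∈ cutPlane ω) {S T : ℝ} (hS : 0 ≤ S) (hT : 0 ≤ T) (hS' : 0 < (y + S * ω).re)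
    (hT' : 0 < (y + T * ω).re) :
    primitiveExtension ω F₀ g S y = primitiveExtension ω F₀ g T y := by
  have hder : ∀ s ∈ Set.uIcc S T,
      HasDerivAt (fun s : ℝ => F₀ (y + s * ω)) (ω * -g (y + s * ω)) s := fun s hs => by
    have hpos : 0 < (y + s * ω).re := by
      rw [Complex.add_re, Complex.re_ofReal_mul] at hS' hT' ⊢
      rcases min_le_iff.1 hs.1 with h | h <;> nlinarith
    have := (hF _ hpos).comp s (hasDerivAt_add_ofReal_mul y ω s)
    rwa [mul_comm] at this
  have hint := intervalIntegrable_ray hg hy hS hT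
  have h1 := intervalIntegral.integral_eq_sub_of_hasDerivAt hder (hint.neg.const_mul ω)
  rw [intervalIntegral.integral_const_mul, intervalIntegral.integral_neg] at h1
  have h2 := intervalIntegral.integral_add_adjacent_intervals
    (intervalIntegrable_ray hg hy le_rfl hS) hint
  rw [primitiveExtension, primitiveExtension, ← h2]
  linear_combination h1

/-- Differentiation under the integral leaves ω g'(y + sω), the s-derivative of g along the ray,
which integrates back to g. -/
lemma hasDerivAt_integral_ray {ω : ℂ} (hω : 0 < ω.re) {g : ℂ → ℂ}
    (hg : AnalyticOnNhd ℂ g (cutPlane ω)) {y : ℂ} (hy : y ∈ cutPlane ω) {T : ℝ} (hT : 0 ≤ T) :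
    HasDerivAt (fun z => ω * ∫ s in (0 : ℝ)..T, g (z + s * ω)) (g (y + T * ω) - g y) y := by
  set K : Set ℂ := (fun s : ℝ => y + s * ω) '' Set.uIcc 0 T with hK
  have hKc : IsCompact K := isCompact_uIcc.image (continuous_add_ofReal_mul y ω)
  have hKU : K ⊆ cutPlane ω := by
    rintro _ ⟨s, hs, rfl⟩
    exact add_mul_mem_cutPlane hy (uIcc_nonneg le_rfl hT hs)
  -- A compact thickening of the segment inside the cut plane bounds g' for all nearby base points,
  -- as dominated differentiation requires.
  obtain ⟨δ, hδ, hsub⟩ := hKc.exists_cthickening_subset_open (isOpen_cutPlane hω) hKU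
  obtain ⟨C, hC⟩ := (hKc.cthickening (r := δ)).exists_bound_of_continuousOn
    (hg.deriv.continuousOn.mono hsub)
  have hmem : ∀ z ∈ Metric.ball y δ, ∀ s ∈ Set.uIcc 0 T,
      z + s * ω ∈ Metric.cthickening δ K := fun z hz s hs => by
    refine Metric.mem_cthickening_of_dist_le _ (y + s * ω) δ K ⟨s, hs, rfl⟩ ?_
    rw [dist_add_right]
    exact (Metric.mem_ball.1 hz).le
  have hcont : ∀ z ∈ Metric.ball y δ, ∀ f : ℂ → ℂ, ContinuousOn f (cutPlane ω) →
      ContinuousOn (fun s : ℝ => f (z + s * ω)) (Set.uIcc 0 T) := fun z hz f hf =>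
    hf.comp (continuous_add_ofReal_mul z ω).continuousOn fun s hs => hsub (hmem z hz s hs)
  have hmeas : ∀ z ∈ Metric.ball y δ, ∀ f : ℂ → ℂ, ContinuousOn f (cutPlane ω) →
      MeasureTheory.AEStronglyMeasurable (fun s : ℝ => f (z + s * ω))
        (MeasureTheory.volume.restrict (Set.uIoc 0 T)) := fun z hz f hf =>
    ((hcont z hz f hf).mono Set.uIoc_subset_uIcc).aestronglyMeasurable measurableSet_uIoc
  have hy0 : y ∈ Metric.ball y δ := Metric.mem_ball_self hδ
  have hmain := (intervalIntegral.hasDerivAt_integral_of_dominated_loc_of_deriv_le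
    (μ := MeasureTheory.volume) (a := 0) (b := T)
    (F := fun z (s : ℝ) => g (z + s * ω)) (F' := fun z (s : ℝ) => deriv g (z + s * ω))
    (x₀ := y) (bound := fun _ => C) (Metric.ball_mem_nhds y hδ)
    (by
      filter_upwards [Metric.ball_mem_nhds y hδ] with z hz using hmeas z hz g hg.continuousOn)
    (hcont y hy0 g hg.continuousOn).intervalIntegrable
    (hmeas y hy0 _ hg.deriv.continuousOn)
    (Eventually.of_forall fun s hs z hz => hC _ (hmem z hz s (Set.uIoc_subset_uIcc hs)))
    intervalIntegrable_const
    (Eventually.of_forall fun s hs z hz => by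
      have := (hg _ (hsub (hmem z hz s (Set.uIoc_subset_uIcc hs)))).differentiableAt.hasDerivAt
      exact this.comp_add_const z (s * ω))).2
  refine (hmain.const_mul ω).congr_deriv ?_
  have hder : ∀ s ∈ Set.uIcc 0 T,
      HasDerivAt (fun s : ℝ => g (y + s * ω)) (ω * deriv g (y + s * ω)) s := fun s hs => by
    have := (hg _ (hsub (hmem y hy0 s hs))).differentiableAt.hasDerivAt.comp s
      (hasDerivAt_add_ofReal_mul y ω s)
    rwa [mul_comm] at this
  have hint := (hcont y hy0 _ hg.deriv.continuousOn).intervalIntegrable (μ := MeasureTheory.volume)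
  have h1 := intervalIntegral.integral_eq_sub_of_hasDerivAt hder (hint.const_mul ω)
  rw [intervalIntegral.integral_const_mul] at h1
  simpa using h1

/-- The primitive of `-g` on the cut plane which extends `F₀`. -/
def cutPlanePrimitive (ω : ℂ) (F₀ g : ℂ → ℂ) (y : ℂ) : ℂ :=
  primitiveExtension ω F₀ g ((‖y‖ + 1) / ω.re) y

lemma cutPlanePrimitive_of_re_pos {ω : ℂ} (hω : 0 < ω.re) {F₀ g : ℂ → ℂ}
    (hg : ContinuousOn g (cutPlane ω)) (hF : ∀ y : ℂ, 0 < y.re → HasDerivAt F₀ (-g y) y) {y : ℂ}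
    (hy : 0 < y.re) : cutPlanePrimitive ω F₀ g y = F₀ y := by
  rw [cutPlanePrimitive, primitiveExtension_congr hω hg hF (mem_cutPlane_of_re_pos hω hy)
    (by positivity) le_rfl (exists_re_add_mul_pos hω y) (by simpa using hy)]
  simp [primitiveExtension]

lemma hasDerivAt_cutPlanePrimitive {ω : ℂ} (hω : 0 < ω.re) {F₀ g : ℂ → ℂ}
    (hg : AnalyticOnNhd ℂ g (cutPlane ω)) (hF : ∀ y : ℂ, 0 < y.re → HasDerivAt F₀ (-g y) y) {y : ℂ}
    (hy : y ∈ cutPlane ω) : HasDerivAt (cutPlanePrimitive ω F₀ g) (-g y) y := by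
  set T : ℝ := (‖y‖ + 1) / ω.re with hT
  have hT0 : 0 ≤ T := by positivity
  have hpos : 0 < (y + T * ω).re := exists_re_add_mul_pos hω y
  -- The length in the definition varies with the point through a norm; near y it may be frozen,
  -- since the value does not depend on it.
  have hev : cutPlanePrimitive ω F₀ g =ᶠ[𝓝 y] primitiveExtension ω F₀ g T := by
    have h1 : ∀ᶠ z in 𝓝 y, 0 < (z + T * ω).re :=
      (isOpen_lt continuous_const
        (by fun_prop : Continuous fun z : ℂ => (z + T * ω).re)).mem_nhds hpos
    filter_upwards [h1, (isOpen_cutPlane hω).mem_nhds hy] with z hz hzc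
    exact primitiveExtension_congr hω hg.continuousOn hF hzc (by positivity) hT0
      (exists_re_add_mul_pos hω z) hz
  refine HasDerivAt.congr_of_eventuallyEq ?_ hev
  have h1 := (hF _ hpos).comp_add_const y (T * ω)
  refine (h1.add (hasDerivAt_integral_ray hω hg hy hT0)).congr_deriv ?_
  ring

lemma analyticOnNhd_cutPlanePrimitive {ω : ℂ} (hω : 0 < ω.re) {F₀ g : ℂ → ℂ}
    (hg : AnalyticOnNhd ℂ g (cutPlane ω)) (hF : ∀ y : ℂ, 0 < y.re → HasDerivAt F₀ (-g y) y) :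
    AnalyticOnNhd ℂ (cutPlanePrimitive ω F₀ g) (cutPlane ω) :=
  DifferentiableOn.analyticOnNhd (fun _ hy =>
    (hasDerivAt_cutPlanePrimitive hω hg hF hy).differentiableAt.differentiableWithinAt)
    (isOpen_cutPlane hω)

/-! ### Polylogarithm series in the half-plane. -/

lemma norm_polylog_term_le (s : ℤ) {z : ℂ} {ρ : ℝ} (hz : ‖z‖ ≤ ρ) (j : ℕ) :
    ‖z ^ (j + 1) / ((j + 1 : ℕ) : ℂ) ^ s‖ ≤
      ‖z‖ * (((j + 1 : ℕ) : ℝ) ^ s.natAbs * ρ ^ j) := by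
  have h1 : (1 : ℝ) ≤ ((j + 1 : ℕ) : ℝ) := by exact_mod_cast Nat.le_add_left 1 j
  have h2 : (((j + 1 : ℕ) : ℝ) ^ s)⁻¹ ≤ ((j + 1 : ℕ) : ℝ) ^ s.natAbs := by
    rw [← zpow_neg, ← zpow_natCast]
    exact zpow_le_zpow_right₀ h1 (by omega)
  rw [norm_div, norm_pow, norm_zpow, Complex.norm_natCast, pow_succ', div_eq_mul_inv, mul_assoc]
  rw [mul_comm (‖z‖ ^ j)]
  gcongr

lemma summable_polylog_bound (a : ℕ) {ρ : ℝ} (h0 : 0 ≤ ρ) (h1 : ρ < 1) :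
    Summable fun j : ℕ => ((j + 1 : ℕ) : ℝ) ^ a * ρ ^ j := by
  rcases h0.eq_or_lt with rfl | h0
  · exact summable_of_ne_finset_zero (s := {0}) fun j hj => by
      have : j ≠ 0 := by simpa using hj
      simp [this]
  have h := (summable_nat_add_iff 1).2 (summable_pow_mul_geometric_of_norm_lt_one a
    (r := ρ) (by rwa [Real.norm_eq_abs, abs_of_pos h0]))
  refine (h.mul_left ρ⁻¹).congr fun j => ?_
  rw [pow_succ]
  field_simp

lemma summable_polylogSeries (s : ℤ) {z : ℂ} (hz : ‖z‖ < 1) :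
    Summable fun j : ℕ => z ^ (j + 1) / ((j + 1 : ℕ) : ℂ) ^ s :=
  Summable.of_norm_bounded ((summable_polylog_bound s.natAbs (norm_nonneg z) hz).mul_left ‖z‖)
    (norm_polylog_term_le s le_rfl)

lemma tendsto_polylogSeries_zero (s : ℤ) : Tendsto (polylogSeries s) (𝓝 0) (𝓝 0) := by
  set C := ∑' j : ℕ, ((j + 1 : ℕ) : ℝ) ^ s.natAbs * (1 / 2 : ℝ) ^ j
  have hs := summable_polylog_bound s.natAbs (ρ := 1 / 2) (by norm_num) (by norm_num)
  refine squeeze_zero_norm' (a := fun z => ‖z‖ * C) ?_ ?_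
  · filter_upwards [Metric.closedBall_mem_nhds (0 : ℂ) (show (0 : ℝ) < 1 / 2 by norm_num)] with z hz
    rw [mem_closedBall_zero_iff] at hz
    exact tsum_of_norm_bounded (hs.hasSum.mul_left ‖z‖) (norm_polylog_term_le s hz)
  · have : Continuous fun z : ℂ => ‖z‖ * C := by fun_prop
    simpa using this.tendsto 0

lemma norm_exp_neg_lt_one {y : ℂ} (hy : 0 < y.re) : ‖Complex.exp (-y)‖ < 1 := by
  rw [Complex.norm_exp, Complex.neg_re, Real.exp_lt_one_iff]
  linarith

/-- Differentiating e^{-jy}/j^s brings down -j. The terms are dominated on Re z > Re y / 2, where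
|e^{-z}| stays below a fixed number less than 1. -/
lemma hasDerivAt_polylogSeries (s : ℤ) {y : ℂ} (hy : 0 < y.re) :
    HasDerivAt (fun y => polylogSeries s (Complex.exp (-y)))
      (-polylogSeries (s - 1) (Complex.exp (-y))) y := by
  set δ := y.re / 2 with hδ
  have hδ0 : 0 < δ := by positivity
  have hρ : Real.exp (-δ) < 1 := Real.exp_lt_one_iff.2 (by linarith)
  have hmem : y ∈ {z : ℂ | δ < z.re} := by
    show δ < y.re
    linarith
  have hsum := summable_polylog_bound (s - 1).natAbs (Real.exp_pos _).le hρ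
  have key := hasDerivAt_tsum_of_isPreconnected (t := {z : ℂ | δ < z.re})
    (g := fun (j : ℕ) y => Complex.exp (-y) ^ (j + 1) / ((j + 1 : ℕ) : ℂ) ^ s)
    (g' := fun (j : ℕ) y => -(Complex.exp (-y) ^ (j + 1) / ((j + 1 : ℕ) : ℂ) ^ (s - 1)))
    hsum (isOpen_lt continuous_const Complex.continuous_re)
    (convex_halfSpace_re_gt δ).isPreconnected ?_ ?_ hmem
    (summable_polylogSeries s (norm_exp_neg_lt_one hy)) hmem
  · rw [tsum_neg] at key
    exact key
  · intro j z _
    have hj : ((j + 1 : ℕ) : ℂ) ≠ 0 := Nat.cast_ne_zero.2 (by omega)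
    have h1 := (((hasDerivAt_neg z).cexp).pow (j + 1)).div_const (((j + 1 : ℕ) : ℂ) ^ s)
    refine h1.congr_deriv ?_
    rw [zpow_sub_one₀ hj]
    have := zpow_ne_zero s hj
    field_simp
    simp only [Nat.add_sub_cancel, pow_succ]
  · intro j z hz
    have h1 : ‖Complex.exp (-z)‖ ≤ Real.exp (-δ) := by
      rw [Complex.norm_exp, Complex.neg_re]
      exact Real.exp_le_exp.2 (by linarith [show δ < z.re from hz])
    rw [norm_neg]
    refine (norm_polylog_term_le (s - 1) h1 j).trans ?_
    exact mul_le_of_le_one_left (by positivity) (h1.trans hρ.le)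

lemma polylogSeries_zero {y : ℂ} (hy : 0 < y.re) :
    polylogSeries 0 (Complex.exp (-y)) = 1 / (Complex.exp y - 1) := by
  have h1 := norm_exp_neg_lt_one hy
  have h2 : polylogSeries 0 (Complex.exp (-y)) = Complex.exp (-y) * (1 - Complex.exp (-y))⁻¹ := by
    rw [polylogSeries, ← tsum_geometric_of_norm_lt_one h1, ← tsum_mul_left]
    refine tsum_congr fun j => ?_
    rw [zpow_zero, div_one, pow_succ']
  have h3 : 1 - Complex.exp (-y) ≠ 0 := fun h => by
    rw [sub_eq_zero] at h
    rw [← h, norm_one] at h1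
    exact lt_irrefl _ h1
  have h4 : Complex.exp y - 1 = Complex.exp y * (1 - Complex.exp (-y)) := by
    rw [mul_sub, ← Complex.exp_add]
    simp
  rw [h2, h4, Complex.exp_neg] at *
  field_simp

lemma polylogSeries_one {z : ℂ} (hz : ‖z‖ < 1) : polylogSeries 1 z = -Complex.log (1 - z) := by
  have h := Complex.hasSum_taylorSeries_neg_log hz
  rw [← h.tsum_eq, h.summable.tsum_eq_zero_add, polylogSeries]
  simp

lemma exp_neg_polylogSeries_one {y : ℂ} (hy : 0 < y.re) :
    Complex.exp (-polylogSeries 1 (Complex.exp (-y))) = 1 - Complex.exp (-y) := by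
  have h1 := norm_exp_neg_lt_one hy
  rw [polylogSeries_one h1, neg_neg, Complex.exp_log]
  intro h
  rw [sub_eq_zero] at h
  rw [← h, norm_one] at h1
  exact lt_irrefl _ h1

/-- The polylogarithm `Li_s(e^{-y})` given by its series, used for `Re y > 0`. -/
def polylogExp (s : ℤ) (y : ℂ) : ℂ := polylogSeries s (Complex.exp (-y))

lemma polylogSum_one (L : ℤ → ℂ → ℂ) (β y : ℂ) :
    polylogSum L 1 β y = -(L 2 y / β) - L 1 y / 2 - β * L 0 y / 12 := by
  simp only [polylogSum, Finset.sum_range_succ, Finset.sum_range_zero, mul_one, bernoulli_zero,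
    bernoulli_one, bernoulli_two, Nat.factorial]
  rw [show ((0 : ℕ) : ℤ) - 1 = -1 by norm_num, show ((1 : ℕ) : ℤ) - 1 = 0 by norm_num,
    show ((2 : ℕ) : ℤ) - 1 = 1 by norm_num, show (2 : ℤ) - ((0 : ℕ) : ℤ) = 2 by norm_num,
    show (2 : ℤ) - ((1 : ℕ) : ℤ) = 1 by norm_num, show (2 : ℤ) - ((2 : ℕ) : ℤ) = 0 by norm_num,
    zpow_neg_one, zpow_zero, zpow_one, inv_neg]
  push_cast
  ring

/-! ### The identity of order one for Re y > 0. -/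

lemma re_add_mul_pos {β y : ℂ} (hβ : 0 < β.re) (hy : 0 < y.re) {t : ℝ} (ht : 0 ≤ t) :
    0 < (y + t * β).re := by
  rw [Complex.add_re, Complex.re_ofReal_mul]
  nlinarith [mul_nonneg ht hβ.le]

lemma hasDerivAt_polylogExp_ray {β y : ℂ} (hβ : 0 < β.re) (hy : 0 < y.re) {t : ℝ} (ht : 0 ≤ t)
    (s : ℤ) : HasDerivAt (fun t : ℝ => polylogExp s (y + t * β))
      (-(β * polylogExp (s - 1) (y + t * β))) t := by
  have := (hasDerivAt_polylogSeries s (re_add_mul_pos hβ hy ht)).comp t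
    (hasDerivAt_add_ofReal_mul y β t)
  refine this.congr_deriv ?_
  rw [polylogExp]
  ring

/-- Integration by parts as for `stirlingDiff`, using that the t-derivative of Li_s(e^{-(y+tβ)}) is
-β Li_{s-1}(e^{-(y+tβ)}). B_3 vanishes at both ends and B_2 takes equal values there. B_1 changes
sign, so Li_1 enters as a sum of its end values rather than a difference; this leaves the extra term
Li_1 at y. -/
lemma integral_bernoulliCubic_mul_polylogExp {β y : ℂ} (hβ : 0 < β.re) (hy : 0 < y.re) :
    ∫ t in (0 : ℝ)..1, β ^ 3 * polylogExp (-2) (y + t * β) * bernoulliCubic t =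
      -6 * (polylogExp 1 y + polylogSum polylogExp 1 β y - polylogSum polylogExp 1 β (y + β)) := by
  have hβ0 : β ≠ 0 := fun h => by simp [h] at hβ
  let G : ℝ → ℂ := fun t => -(β ^ 2 * polylogExp (-1) (y + t * β) * bernoulliCubic t)
    - 3 * β * polylogExp 0 (y + t * β) * ((t : ℂ) ^ 2 - t + 1 / 6)
    - 6 * polylogExp 1 (y + t * β) * ((t : ℂ) - 1 / 2) - 6 / β * polylogExp 2 (y + t * β)
  have hG : ∀ t ∈ Set.uIcc (0 : ℝ) 1,
      HasDerivAt G (β ^ 3 * polylogExp (-2) (y + t * β) * bernoulliCubic t) t := fun t ht => by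
    have ht0 := uIcc_nonneg le_rfl zero_le_one ht
    have h1 := hasDerivAt_polylogExp_ray hβ hy ht0 (-1)
    have h2 := hasDerivAt_polylogExp_ray hβ hy ht0 0
    have h3 := hasDerivAt_polylogExp_ray hβ hy ht0 1
    have h4 := hasDerivAt_polylogExp_ray hβ hy ht0 2
    norm_num at h1 h2 h3 h4
    have d1 : HasDerivAt (fun t : ℝ => bernoulliCubic t) (3 * (t : ℂ) ^ 2 - 3 * t + 1 / 2) t := by
      have := (((hasDerivAt_pow 3 (t : ℂ))).sub ((hasDerivAt_pow 2 (t : ℂ)).const_mul (3 / 2))).add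
        ((hasDerivAt_id (t : ℂ)).const_mul (1 / 2))
      refine (this.congr_deriv (f' := _) (g' := 3 * (t : ℂ) ^ 2 - 3 * t + 1 / 2) ?_).comp_ofReal
      simp; ring
    have d2 : HasDerivAt (fun t : ℝ => (t : ℂ) ^ 2 - t + 1 / 6) (2 * (t : ℂ) - 1) t := by
      have := ((hasDerivAt_pow 2 (t : ℂ)).sub (hasDerivAt_id (t : ℂ))).add_const (1 / 6)
      refine (this.congr_deriv (f' := _) (g' := 2 * (t : ℂ) - 1) ?_).comp_ofReal
      simp
    have d3 : HasDerivAt (fun t : ℝ => (t : ℂ) - 1 / 2) 1 t :=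
      ((hasDerivAt_id (t : ℂ)).sub_const (1 / 2)).comp_ofReal
    have := (((((h1.const_mul (β ^ 2)).mul d1).neg).sub ((h2.const_mul (3 * β)).mul d2)).sub
      ((h3.const_mul 6).mul d3)).sub (h4.const_mul (6 / β))
    refine this.congr_deriv ?_
    simp only [bernoulliCubic]
    field_simp
    ring
  have hint : IntervalIntegrable
      (fun t : ℝ => β ^ 3 * polylogExp (-2) (y + t * β) * bernoulliCubic t)
      MeasureTheory.volume 0 1 := by
    apply ContinuousOn.intervalIntegrable
    refine ContinuousOn.mul (ContinuousOn.mul continuousOn_const fun t ht => ?_)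
      (by unfold bernoulliCubic; fun_prop)
    exact (hasDerivAt_polylogExp_ray hβ hy (uIcc_nonneg le_rfl zero_le_one ht)
      (-2)).continuousAt.continuousWithinAt
  rw [intervalIntegral.integral_eq_sub_of_hasDerivAt hG hint]
  simp only [G, polylogSum_one, bernoulliCubic]
  push_cast
  rw [zero_mul, add_zero, one_mul]
  field_simp
  ring

lemma hasSum_stirlingDiff_latticePoint {β y : ℂ} (hβ : 0 < β.re) (hy : 0 < y.re) :
    HasSum (fun n : ℤ => stirlingDiff (latticePoint β y n))
      (polylogExp 1 y + polylogSum polylogExp 1 β y - polylogSum polylogExp 1 β (y + β)) := by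
  have hβ0 : β ≠ 0 := fun h => by simp [h] at hβ
  obtain ⟨K, hK⟩ := exists_le_norm_latticePoint_add hβ hy
  have hne : ∀ (n : ℤ) (t : ℝ), 0 ≤ t → latticePoint β y n + t ≠ 0 := fun n t ht h => by
    have := hK n t ht
    rw [h, norm_zero, mul_zero] at this
    linarith [abs_nonneg (n : ℝ)]
  have hsum : HasSum (fun n : ℤ => ∫ t in (0 : ℝ)..1,
      bernoulliCubic t / (latticePoint β y n + t) ^ 3)
      (∫ t in (0 : ℝ)..1, β ^ 3 * polylogExp (-2) (y + t * β) * bernoulliCubic t / 2) := by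
    refine intervalIntegral.hasSum_integral_of_dominated_convergence
      (fun n _ => K ^ 3 * ((1 + |(n : ℝ)|) ^ (3 / 2 : ℝ))⁻¹) ?_ ?_ ?_ ?_ ?_
    · intro n
      refine ContinuousOn.aestronglyMeasurable ?_ measurableSet_uIoc
      refine ContinuousOn.div (by unfold bernoulliCubic; fun_prop) (by fun_prop) fun t ht => ?_
      exact pow_ne_zero _ (hne n t (uIcc_nonneg le_rfl zero_le_one (Set.uIoc_subset_uIcc ht)))
    · refine fun n => Eventually.of_forall fun t ht => ?_
      rw [Set.uIoc_of_le zero_le_one] at ht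
      rw [norm_div, norm_pow]
      have h1 : 1 + |(n : ℝ)| ≤ K * ‖latticePoint β y n + t‖ := by
        linarith [hK n t ht.1.le, ht.1]
      refine le_trans ?_ (inv_pow_le_rpow (by linarith [abs_nonneg (n : ℝ)]) h1
        (norm_nonneg _) (by norm_num : 2 ≤ 3))
      gcongr
      exact norm_bernoulliCubic_le ht.1.le ht.2
    · exact Eventually.of_forall fun t _ => summable_one_add_abs_rpow_inv.mul_left _
    · exact intervalIntegrable_const
    · refine Eventually.of_forall fun t ht => ?_
      have ht0 := uIcc_nonneg le_rfl zero_le_one (Set.uIoc_subset_uIcc ht)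
      have h1 := latticeSum_of_re_pos (k := 2) (by norm_num) (re_add_mul_pos hβ hy ht0)
      have h2 := ((summable_latticeSum (m := 3) (by norm_num) (y + t * β)).hasSum.mul_left
        (β ^ 3 * bernoulliCubic t))
      have h3 : β ^ 3 * bernoulliCubic t *
          ∑' n : ℤ, 1 / (y + t * β + 2 * Real.pi * Complex.I * n) ^ 3 =
          β ^ 3 * polylogExp (-2) (y + t * β) * bernoulliCubic t / 2 := by
        have h4 : polylogExp (-2) (y + t * β) =
            2 * ∑' n : ℤ, 1 / (y + t * β + 2 * Real.pi * Complex.I * n) ^ 3 := by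
          simpa [latticeSum, polylogExp] using h1.symm
        rw [h4]
        ring
      rw [h3] at h2
      convert! h2 using 2 with n
      rw [latticePoint_add hβ, div_pow]
      have h5 : y + t * β + 2 * Real.pi * Complex.I * n =
        y + (2 * Real.pi * Complex.I * n + β * t) := by ring
      rw [h5]
      simp only [div_eq_mul_inv, mul_inv, inv_inv, one_mul]
      ring
  -- The constants multiply to -(1/3) · (1/2) · (-6) = 1.
  have h := hsum.mul_left (-(1 / 3) : ℂ)
  rw [intervalIntegral.integral_div, integral_bernoulliCubic_mul_polylogExp hβ hy] at h
  convert! h using 1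
  ring

lemma tendsto_exp_neg_add_mul {β : ℂ} (hβ : 0 < β.re) (y : ℂ) :
    Tendsto (fun j : ℕ => Complex.exp (-(y + j * β))) atTop (𝓝 0) := by
  rw [tendsto_zero_iff_norm_tendsto_zero]
  have : ∀ j : ℕ, ‖Complex.exp (-(y + j * β))‖ = Real.exp (-y.re) * Real.exp (-β.re) ^ j := by
    intro j
    rw [Complex.norm_exp, ← Real.exp_nat_mul, ← Real.exp_add]
    simp
    ring
  simp_rw [this]
  have h := (tendsto_pow_atTop_nhds_zero_of_lt_one (Real.exp_pos (-β.re)).le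
    (Real.exp_lt_one_iff.2 (by linarith))).const_mul (Real.exp (-y.re))
  rwa [mul_zero] at h

lemma tendsto_polylogSum_one {β : ℂ} (hβ : 0 < β.re) (y : ℂ) :
    Tendsto (fun j : ℕ => polylogSum polylogExp 1 β (y + j * β)) atTop (𝓝 0) := by
  have h : ∀ s : ℤ, Tendsto (fun j : ℕ => polylogExp s (y + j * β)) atTop (𝓝 0) := fun s =>
    (tendsto_polylogSeries_zero s).comp (tendsto_exp_neg_add_mul hβ y)
  simp_rw [polylogSum_one]
  have := ((((h 2).div_const β).neg).sub ((h 1).div_const 2)).sub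
    (((h 0).const_mul β).div_const 12)
  simpa using this

lemma multipliable_qPochhammer {q : ℂ} (hq : ‖q‖ < 1) (z : ℂ) :
    Multipliable fun j : ℕ => 1 - z * q ^ j := by
  have : Summable fun j : ℕ => ‖-(z * q ^ j)‖ := by
    simp_rw [norm_neg, norm_mul, norm_pow]
    exact (summable_geometric_of_lt_one (norm_nonneg q) hq).mul_left _
  simpa [sub_eq_add_neg] using multipliable_one_add_of_summable this

lemma latticePoint_add_natCast {β : ℂ} (hβ : 0 < β.re) (y : ℂ) (n : ℤ) (j : ℕ) :
    latticePoint β y n + j = latticePoint β (y + j * β) n := by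
  rw [latticePoint_add hβ, latticePoint]
  ring

lemma summable_rpow_inv_prod : Summable fun p : ℤ × ℕ =>
    ((1 + |(p.1 : ℝ)|) ^ (3 / 2 : ℝ))⁻¹ * ((1 + (p.2 : ℝ)) ^ (3 / 2 : ℝ))⁻¹ := by
  have h1 : (0 : ℤ → ℝ) ≤ fun n : ℤ => ((1 + |(n : ℝ)|) ^ (3 / 2 : ℝ))⁻¹ := fun n =>
    inv_nonneg.2 (Real.rpow_nonneg (by positivity) _)
  have h2 : (0 : ℕ → ℝ) ≤ fun j : ℕ => ((1 + (j : ℝ)) ^ (3 / 2 : ℝ))⁻¹ := fun j =>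
    inv_nonneg.2 (Real.rpow_nonneg (by positivity) _)
  exact summable_one_add_abs_rpow_inv.mul_of_nonneg summable_one_add_rpow_inv h1 h2

/-- One absolutely convergent double series, summed in both orders: over j first it gives the
remainders f_1, over n first the telescoping terms. -/
lemma exists_hasSum_stirlingRemainder_one {β y : ℂ} (hβ : 0 < β.re) (hy : 0 < y.re) :
    ∃ S : ℂ, HasSum (fun n : ℤ => stirlingRemainder 1 (latticePoint β y n)) S ∧
      HasSum (fun j : ℕ => polylogExp 1 (y + j * β) + polylogSum polylogExp 1 β (y + j * β) -
        polylogSum polylogExp 1 β (y + (j + 1 : ℕ) * β)) S := by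
  obtain ⟨K, hK⟩ := exists_le_norm_latticePoint_add hβ hy
  have hr : ∀ n : ℤ, 1 ≤ 1 + |(n : ℝ)| := fun n => by linarith [abs_nonneg (n : ℝ)]
  have hsum : Summable fun p : ℤ × ℕ => stirlingDiff (latticePoint β y p.1 + p.2) :=
    Summable.of_norm_bounded (summable_rpow_inv_prod.mul_left (K ^ 3)) fun p =>
      norm_stirlingDiff_add_le (hr p.1) (hK p.1) p.2
  obtain ⟨S, hS⟩ := hsum
  have hrow : ∀ n : ℤ, HasSum (fun j : ℕ => stirlingDiff (latticePoint β y n + j))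
      (stirlingRemainder 1 (latticePoint β y n)) := fun n =>
    hasSum_stirlingDiff (hr n) (hK n)
  have hS1 : HasSum (fun n : ℤ => stirlingRemainder 1 (latticePoint β y n)) S :=
    HasSum.prod_fiberwise hS hrow
  have hS2 : HasSum (fun p : ℕ × ℤ => stirlingDiff (latticePoint β y p.2 + p.1)) S :=
    (Equiv.prodComm ℕ ℤ).hasSum_iff.2 hS
  refine ⟨S, hS1, hS2.prod_fiberwise fun j => ?_⟩
  have h1 := hasSum_stirlingDiff_latticePoint hβ (re_add_mul_pos hβ hy (Nat.cast_nonneg j))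
  have h2 : y + (j + 1 : ℕ) * β = y + ((j : ℝ) : ℂ) * β + β := by
    push_cast
    ring
  rw [h2]
  simp only [latticePoint_add_natCast hβ]
  exact h1

/-- The identity of order one in the half-plane. -/
lemma hasSum_stirlingRemainder_one {β y : ℂ} (hβ : 0 < β.re) (hy : 0 < y.re) :
    ∃ S : ℂ, HasSum (fun n : ℤ => stirlingRemainder 1 (latticePoint β y n)) S ∧
      qPochhammerInf (Complex.exp (-y)) (Complex.exp (-β)) =
        Complex.exp (polylogSum polylogExp 1 β y - S) := by
  obtain ⟨S, hS, hS2⟩ := exists_hasSum_stirlingRemainder_one hβ hy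
  refine ⟨S, hS, ?_⟩
  set P : ℂ → ℂ := polylogSum polylogExp 1 β with hP
  -- The telescoped partial sums leave only the logarithms of the Pochhammer factors; the boundary
  -- term at y + Jβ tends to 0.
  have hpart : ∀ J : ℕ, -(∑ j ∈ Finset.range J, (polylogExp 1 (y + j * β) +
      P (y + j * β) - P (y + (j + 1 : ℕ) * β)) + P (y + J * β)) + P y =
      ∑ j ∈ Finset.range J, -polylogExp 1 (y + j * β) := fun J => by
    induction J with
    | zero => simp
    | succ J ih =>
      rw [Finset.sum_range_succ, Finset.sum_range_succ, ← ih]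
      ring
  have hlim := (((hS2.tendsto_sum_nat.add (tendsto_polylogSum_one hβ y)).neg).add_const (P y)).cexp
  have hprod := (multipliable_qPochhammer (norm_exp_neg_lt_one hβ)
    (Complex.exp (-y))).hasProd.tendsto_prod_nat
  rw [add_zero, neg_add_eq_sub] at hlim
  refine tendsto_nhds_unique hprod (hlim.congr fun J => ?_)
  rw [hpart, Complex.exp_sum]
  refine Finset.prod_congr rfl fun j _ => ?_
  have h1 := exp_neg_polylogSeries_one (re_add_mul_pos hβ hy (Nat.cast_nonneg j))
  rw [Complex.ofReal_natCast] at h1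
  rw [polylogExp, h1, neg_add, Complex.exp_add, ← Complex.exp_nat_mul, mul_neg]

/-! ### Branches of the polylogarithms and the identity theorem. -/

/-- The branch of `Li_s(e^{-y})` on the cut plane, for `s ≤ 2`. -/
def polylogBranch (ω : ℂ) (s : ℤ) : ℂ → ℂ :=
  if s = 2 then cutPlanePrimitive ω (polylogExp 2)
    (cutPlanePrimitive ω (polylogExp 1) fun y => 1 / (Complex.exp y - 1))
  else if s = 1 then cutPlanePrimitive ω (polylogExp 1) fun y => 1 / (Complex.exp y - 1)
  else if s = 0 then fun y => 1 / (Complex.exp y - 1)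
  else fun y => ((-s).toNat.factorial : ℂ) * latticeSum ((-s).toNat + 1) y

lemma polylogBranch_zero (ω y : ℂ) : polylogBranch ω 0 y = 1 / (Complex.exp y - 1) := by
  simp [polylogBranch]

lemma polylogBranch_neg (ω : ℂ) {k : ℕ} (hk : 1 ≤ k) (y : ℂ) :
    polylogBranch ω (-(k : ℤ)) y = (k.factorial : ℂ) * latticeSum (k + 1) y := by
  have h2 : -(k : ℤ) ≠ 2 := by omega
  have h1 : -(k : ℤ) ≠ 1 := by omega
  have h0 : -(k : ℤ) ≠ 0 := by omega
  simp only [polylogBranch, if_neg h2, if_neg h1, if_neg h0, neg_neg, Int.toNat_natCast]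

lemma exp_sub_one_ne_zero {ω y : ℂ} (hy : y ∈ cutPlane ω) : Complex.exp y - 1 ≠ 0 := fun h => by
  rw [sub_eq_zero, Complex.exp_eq_one_iff] at h
  obtain ⟨n, hn⟩ := h
  refine add_ne_zero_of_mem_cutPlane hy (-n) ?_
  rw [hn]
  push_cast
  ring

lemma isPolylogBranch_polylogBranch {ω : ℂ} (hω : 0 < ω.re) {s : ℤ} (hs : s ≤ 2) :
    IsPolylogBranch ω s (polylogBranch ω s) := by
  have hU := isOpen_cutPlane hω
  have g0 : AnalyticOnNhd ℂ (fun y => 1 / (Complex.exp y - 1)) (cutPlane ω) := by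
    refine DifferentiableOn.analyticOnNhd (fun y hy => ?_) hU
    exact ((differentiableAt_const _).div (Complex.differentiableAt_exp.sub_const 1)
      (exp_sub_one_ne_zero hy)).differentiableWithinAt
  have d1 : ∀ y : ℂ, 0 < y.re →
      HasDerivAt (polylogExp 1) (-(fun y => 1 / (Complex.exp y - 1)) y) y := fun y hy => by
    have := hasDerivAt_polylogSeries 1 hy
    rw [sub_self, polylogSeries_zero hy] at this
    exact this
  have g1 := analyticOnNhd_cutPlanePrimitive hω g0 d1
  have e1 : ∀ y : ℂ, 0 < y.re → cutPlanePrimitive ω (polylogExp 1)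
      (fun y => 1 / (Complex.exp y - 1)) y = polylogExp 1 y := fun y hy =>
    cutPlanePrimitive_of_re_pos hω g0.continuousOn d1 hy
  have d2 : ∀ y : ℂ, 0 < y.re → HasDerivAt (polylogExp 2)
      (-cutPlanePrimitive ω (polylogExp 1) (fun y => 1 / (Complex.exp y - 1)) y) y := fun y hy => by
    rw [e1 y hy]
    exact hasDerivAt_polylogSeries 2 hy
  by_cases h2 : s = 2
  · subst h2
    simp only [polylogBranch, if_true]
    exact ⟨analyticOnNhd_cutPlanePrimitive hω g1 d2, fun y hy =>
      cutPlanePrimitive_of_re_pos hω g1.continuousOn d2 hy⟩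
  by_cases h1 : s = 1
  · subst h1
    simp only [polylogBranch, if_neg h2, if_true]
    exact ⟨g1, e1⟩
  by_cases h0 : s = 0
  · subst h0
    simp only [polylogBranch, if_neg h2, if_neg h1, if_true]
    exact ⟨g0, fun y hy => (polylogSeries_zero hy).symm⟩
  obtain ⟨k, rfl⟩ : ∃ k : ℕ, s = -(k : ℤ) := ⟨(-s).toNat, by omega⟩
  have hk : 1 ≤ k := by omega
  have : polylogBranch ω (-(k : ℤ)) = fun y => (k.factorial : ℂ) * latticeSum (k + 1) y :=
    funext fun y => polylogBranch_neg ω hk y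
  rw [this]
  exact ⟨analyticOnNhd_const.mul (analyticOnNhd_latticeSum hω (by omega)), fun y hy =>
    latticeSum_of_re_pos hk hy⟩

lemma polylogBranch_of_re_pos {ω : ℂ} (hω : 0 < ω.re) {s : ℤ} (hs : s ≤ 2) {y : ℂ}
    (hy : 0 < y.re) : polylogBranch ω s y = polylogExp s y :=
  (isPolylogBranch_polylogBranch hω hs).2 y hy

/-- Identity theorem on the cut plane. -/
lemma eqOn_cutPlane_of_re_pos {ω : ℂ} (hω : 0 < ω.re) {f g : ℂ → ℂ}
    (hf : DifferentiableOn ℂ f (cutPlane ω)) (hg : DifferentiableOn ℂ g (cutPlane ω))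
    (h : ∀ y : ℂ, 0 < y.re → f y = g y) : Set.EqOn f g (cutPlane ω) := by
  have hU := isOpen_cutPlane hω
  refine (hf.analyticOnNhd hU).eqOn_of_preconnected_of_eventuallyEq (hg.analyticOnNhd hU)
    (isPreconnected_cutPlane hω) (mem_cutPlane_of_re_pos hω (y := 1) (by simp)) ?_
  filter_upwards [(isOpen_lt continuous_const Complex.continuous_re).mem_nhds
    (show (0 : ℝ) < (1 : ℂ).re by simp)] with y hy using h y hy

lemma exp_neg_polylogBranch_one {ω : ℂ} (hω : 0 < ω.re) {y : ℂ} (hy : y ∈ cutPlane ω) :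
    Complex.exp (-polylogBranch ω 1 y) = 1 - Complex.exp (-y) := by
  have h := (isPolylogBranch_polylogBranch hω (s := 1) (by norm_num)).1.differentiableOn
  refine eqOn_cutPlane_of_re_pos hω (f := fun y => Complex.exp (-polylogBranch ω 1 y))
    (g := fun y => 1 - Complex.exp (-y)) h.neg.cexp (by fun_prop) (fun y hy => ?_) hy
  rw [polylogBranch_of_re_pos hω (by norm_num) hy]
  exact exp_neg_polylogSeries_one hy

/-! ### Holomorphy of the products and continuation to the cut plane. -/

lemma differentiableOn_tprod_one_add {ι : Type*} {f : ι → ℂ → ℂ} {U : Set ℂ} (hU : IsOpen U)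
    {u : ι → ℝ} (hu : Summable u) (hb : ∀ᶠ i in cofinite, ∀ y ∈ U, ‖f i y‖ ≤ u i)
    (hf : ∀ i, DifferentiableOn ℂ (f i) U) :
    (∀ y ∈ U, Multipliable fun i => 1 + f i y) ∧
      DifferentiableOn ℂ (fun y => ∏' i, (1 + f i y)) U := by
  have h := Summable.hasProdLocallyUniformlyOn_one_add hU hu hb fun i => (hf i).continuousOn
  refine ⟨fun y hy => (h.hasProd hy).multipliable, ?_⟩
  refine (hasProdLocallyUniformlyOn_iff_tendstoLocallyUniformlyOn.1 h).differentiableOn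
    (Eventually.of_forall fun s => ?_) hU
  exact DifferentiableOn.fun_finsetProd fun i _ => (differentiableOn_const _).add (hf i)

lemma differentiable_qPochhammerInf {q : ℂ} (hq : ‖q‖ < 1) :
    Differentiable ℂ fun y => qPochhammerInf (Complex.exp (-y)) q := by
  intro y₀
  have hball := Metric.ball_mem_nhds y₀ one_pos
  have h := differentiableOn_tprod_one_add (f := fun (j : ℕ) y => -(Complex.exp (-y) * q ^ j))
    (U := Metric.ball y₀ 1) Metric.isOpen_ball
    ((summable_geometric_of_lt_one (norm_nonneg q) hq).mul_left (Real.exp (‖y₀‖ + 1)))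
    (Eventually.of_forall fun j y hy => by
      rw [norm_neg, norm_mul, norm_pow, Complex.norm_exp]
      gcongr
      have h1 : ‖y‖ ≤ ‖y₀‖ + 1 := by
        have := norm_le_norm_add_norm_sub' y y₀
        rw [← dist_eq_norm] at this
        linarith [Metric.mem_ball.1 hy]
      rw [Complex.neg_re]
      linarith [(abs_le.1 (Complex.abs_re_le_norm y)).1])
    (fun j => by fun_prop)
  exact (h.2.congr fun y _ => by simp only [qPochhammerInf, sub_eq_add_neg]).differentiableAt hball

lemma stirlingFactor_eq_exp {N : ℕ} {x l g : ℂ} (hg : Complex.exp g = Complex.Gamma x) :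
    stirlingFactor N x l = Complex.exp (-stirlingRemainderOf N x l g) := by
  have hs : (Real.sqrt (2 * Real.pi) : ℂ) =
      Complex.exp ((1 / 2) * (Real.log (2 * Real.pi) : ℂ)) := by
    have hp : 0 < 2 * Real.pi := Real.two_pi_pos
    rw [← Real.exp_log (Real.sqrt_pos.2 hp), Real.log_sqrt hp.le]
    push_cast
    ring_nf
  rw [stirlingFactor, hs, ← hg, ← Complex.exp_neg, ← Complex.exp_add, ← Complex.exp_add,
    stirlingRemainderOf]
  ring_nf

lemma exists_stirlingRemainder_one_bound {ω β : ℂ} (hω : 0 < ω.re) (hβ : 0 < β.re) (R : ℝ) :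
    ∃ C M : ℝ, ∀ y : ℂ, ‖y‖ ≤ R → ∀ n : ℤ, M ≤ |(n : ℝ)| →
      latticePoint β y n ∈ Complex.slitPlane ∧
      latticeLog ω β y n = Complex.log (latticePoint β y n) ∧
      ‖stirlingRemainder 1 (latticePoint β y n)‖ ≤ C * ((1 + |(n : ℝ)|) ^ (3 / 2 : ℝ))⁻¹ := by
  obtain ⟨K, M₁, h₁⟩ := exists_le_norm_latticePoint_add_of_norm_le hβ R
  obtain ⟨M₂, h₂⟩ := exists_latticeLog_eq_log hω hβ R
  refine ⟨K ^ 3 * rpowSum, max M₁ M₂, fun y hy n hn => ?_⟩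
  have h1 := h₁ y hy n ((le_max_left _ _).trans hn)
  have hr : 1 ≤ 1 + |(n : ℝ)| := by linarith [abs_nonneg (n : ℝ)]
  exact ⟨mem_slitPlane_of_le_norm hr h1, h₂ y hy n ((le_max_right _ _).trans hn),
    norm_stirlingRemainder_one_le hr h1⟩

/-- Poles of Γ at a lattice point do no harm because 1/Γ is entire; only the logarithm and 1/x need
the cut plane. -/
lemma differentiableOn_stirlingFactor_one {ω β : ℂ} (hω : 0 < ω.re) (hβ : 0 < β.re) (n : ℤ) :
    DifferentiableOn ℂ (fun y => stirlingFactor 1 (latticePoint β y n) (latticeLog ω β y n))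
      (cutPlane ω) := by
  intro y hy
  have hβ0 : β ≠ 0 := fun h => by simp [h] at hβ
  have h1 : latticePoint β y n ≠ 0 := div_ne_zero (add_ne_zero_of_mem_cutPlane hy n) hβ0
  have h2 : DifferentiableAt ℂ (fun y => latticePoint β y n) y := by
    unfold latticePoint
    fun_prop
  have h3 : DifferentiableAt ℂ (fun y => latticeLog ω β y n) y := by
    unfold latticeLog
    have h6 : DifferentiableAt ℂ (fun y : ℂ => (y + 2 * Real.pi * Complex.I * n) / ω) y := by
      fun_prop
    exact (h6.clog ((mem_cutPlane_iff hω).1 hy n)).add_const _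
  have h4 : DifferentiableAt ℂ (fun y => (Complex.Gamma (latticePoint β y n))⁻¹) y :=
    (Complex.differentiable_one_div_Gamma _).comp y h2
  have h5 : DifferentiableAt ℂ (fun y => 1 / (12 * latticePoint β y n)) y :=
    (differentiableAt_const _).div (h2.const_mul 12) (mul_ne_zero (by norm_num) h1)
  simp only [stirlingFactor, stirlingSum_one]
  exact ((h4.const_mul _).mul ((((h2.sub_const _).mul h3).sub h2).add h5).cexp)
    |>.differentiableWithinAt

lemma stirlingFactor_prod_differentiable {ω β : ℂ} (hω : 0 < ω.re) (hβ : 0 < β.re) :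
    (∀ y ∈ cutPlane ω, Multipliable fun n : ℤ =>
      stirlingFactor 1 (latticePoint β y n) (latticeLog ω β y n)) ∧
    DifferentiableOn ℂ (fun y => ∏' n : ℤ,
      stirlingFactor 1 (latticePoint β y n) (latticeLog ω β y n)) (cutPlane ω) := by
  have key : ∀ y₀ ∈ cutPlane ω, ∃ U ∈ 𝓝 y₀, (∀ y ∈ U, Multipliable fun n : ℤ =>
      stirlingFactor 1 (latticePoint β y n) (latticeLog ω β y n)) ∧
      DifferentiableOn ℂ (fun y => ∏' n : ℤ,
        stirlingFactor 1 (latticePoint β y n) (latticeLog ω β y n)) U := by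
    intro y₀ hy₀
    -- Restricting to a ball bounds y, which makes the exceptional set of n and the estimate for f_1
    -- uniform. In the tail |exp(-f_1) - 1| ≤ 2|f_1|.
    have hU : IsOpen (cutPlane ω ∩ Metric.ball y₀ 1) :=
      (isOpen_cutPlane hω).inter Metric.isOpen_ball
    obtain ⟨C, M, h⟩ := exists_stirlingRemainder_one_bound hω hβ (‖y₀‖ + 1)
    have hu := summable_one_add_abs_rpow_inv.mul_left C
    have hmain := differentiableOn_tprod_one_add (f := fun (n : ℤ) y =>
      stirlingFactor 1 (latticePoint β y n) (latticeLog ω β y n) - 1) hU (hu.mul_left 2)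
      (by
        filter_upwards [eventually_le_abs_intCast M,
          hu.tendsto_cofinite_zero.eventually_le_const one_pos] with n hn hn1 y hy
        have hyR : ‖y‖ ≤ ‖y₀‖ + 1 := by
          have := norm_le_norm_add_norm_sub' y y₀
          rw [← dist_eq_norm] at this
          linarith [Metric.mem_ball.1 hy.2]
        obtain ⟨h1, h2, h3⟩ := h y hyR n hn
        rw [stirlingFactor_eq_exp (exp_logGamma h1), h2]
        have h4 : ‖-stirlingRemainder 1 (latticePoint β y n)‖ ≤ 1 := by
          rw [norm_neg]; exact h3.trans hn1
        refine (Complex.norm_exp_sub_one_le h4).trans ?_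
        rw [norm_neg]
        gcongr)
      (fun n => ((differentiableOn_stirlingFactor_one hω hβ n).mono
        Set.inter_subset_left).sub_const 1)
    simp only [add_sub_cancel] at hmain
    exact ⟨_, hU.mem_nhds ⟨hy₀, Metric.mem_ball_self one_pos⟩, hmain⟩
  constructor
  · intro y hy
    obtain ⟨U, hU, h, -⟩ := key y hy
    exact h y (mem_of_mem_nhds hU)
  · intro y hy
    obtain ⟨U, hU, -, h⟩ := key y hy
    exact (h.differentiableAt hU).differentiableWithinAt

/-- The product formula of order one on the cut plane. -/
lemma qPochhammerInf_eq_one {ω β : ℂ} (hω : 0 < ω.re) (hβ : 0 < β.re) {y : ℂ}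
    (hy : y ∈ cutPlane ω) :
    qPochhammerInf (Complex.exp (-y)) (Complex.exp (-β)) =
      Complex.exp (polylogSum (polylogBranch ω) 1 β y) *
        ∏' n : ℤ, stirlingFactor 1 (latticePoint β y n) (latticeLog ω β y n) := by
  have hL : ∀ s : ℤ, s ≤ 2 → DifferentiableOn ℂ (polylogBranch ω s) (cutPlane ω) := fun s hs =>
    (isPolylogBranch_polylogBranch hω hs).1.differentiableOn
  have hP : DifferentiableOn ℂ (polylogSum (polylogBranch ω) 1 β) (cutPlane ω) := by
    have : polylogSum (polylogBranch ω) 1 β = fun y => -(polylogBranch ω 2 y / β) -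
        polylogBranch ω 1 y / 2 - β * polylogBranch ω 0 y / 12 :=
      funext fun y => polylogSum_one _ _ _
    rw [this]
    exact (((hL 2 le_rfl).div_const β).neg.sub ((hL 1 (by norm_num)).div_const 2)).sub
      (((hL 0 (by norm_num)).const_mul β).div_const 12)
  refine eqOn_cutPlane_of_re_pos hω
    (f := fun y => qPochhammerInf (Complex.exp (-y)) (Complex.exp (-β)))
    (g := fun y => Complex.exp (polylogSum (polylogBranch ω) 1 β y) *
        ∏' n : ℤ, stirlingFactor 1 (latticePoint β y n) (latticeLog ω β y n))
    (differentiable_qPochhammerInf (norm_exp_neg_lt_one hβ)).differentiableOn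
    (hP.cexp.mul (stirlingFactor_prod_differentiable hω hβ).2) (fun y hy => ?_) hy
  obtain ⟨S, hS, hq⟩ := hasSum_stirlingRemainder_one hβ hy
  have hsl : ∀ n : ℤ, latticePoint β y n ∈ Complex.slitPlane := fun n => by
    have hz : 0 < (y + 2 * Real.pi * Complex.I * n).re := by rwa [add_two_pi_re]
    exact div_mem_slitPlane hz hβ
  have hfac : (fun n : ℤ => stirlingFactor 1 (latticePoint β y n) (latticeLog ω β y n)) =
      Complex.exp ∘ fun n : ℤ => -stirlingRemainder 1 (latticePoint β y n) := funext fun n => by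
    rw [stirlingFactor_eq_exp (exp_logGamma (hsl n)), latticeLog_of_re_pos hω hβ hy]
    rfl
  rw [hq, hfac, hS.neg.cexp.tprod_eq, polylogSum_one, polylogSum_one,
    polylogBranch_of_re_pos hω le_rfl hy, polylogBranch_of_re_pos hω (by norm_num) hy,
    polylogBranch_of_re_pos hω (by norm_num) hy, ← Complex.exp_add, sub_eq_add_neg]

/-! ### From order one to order N. -/

lemma stirlingSum_succ (N : ℕ) (x : ℂ) :
    stirlingSum (N + 1) x = stirlingSum N x + ((bernoulli (2 * (N + 1)) : ℚ) : ℂ) /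
      ((2 * N + 2) * (2 * N + 1)) * (1 / x ^ (2 * N + 1)) := by
  rw [stirlingSum, stirlingSum, Finset.sum_Icc_succ_top (by omega),
    show 2 * (N + 1) - 1 = 2 * N + 1 by omega, mul_one_div, div_div]
  congr 3
  push_cast
  ring

lemma polylogSum_succ {N : ℕ} (hN : 1 ≤ N) (L : ℤ → ℂ → ℂ) (β y : ℂ) :
    polylogSum L (N + 1) β y = polylogSum L N β y - ((bernoulli (2 * (N + 1)) : ℚ) : ℂ) *
      L (-((2 * N : ℕ) : ℤ)) y * β ^ (2 * N + 1) / ((2 * N + 2).factorial : ℂ) := by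
  rw [polylogSum, polylogSum, show 2 * (N + 1) + 1 = 2 * N + 1 + 1 + 1 by ring,
    Finset.sum_range_succ, Finset.sum_range_succ,
    bernoulli_eq_zero_of_odd (n := 2 * N + 1) ⟨N, rfl⟩ (by omega),
    show (2 : ℤ) - ((2 * N + 1 + 1 : ℕ) : ℤ) = -((2 * N : ℕ) : ℤ) by push_cast; ring,
    show ((2 * N + 1 + 1 : ℕ) : ℤ) - 1 = ((2 * N + 1 : ℕ) : ℤ) by push_cast; ring, zpow_natCast,
    Odd.neg_pow ⟨N, rfl⟩, show 2 * N + 1 + 1 = 2 * (N + 1) by ring]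
  simp only [Rat.cast_zero, zero_mul, zero_div, add_zero]
  ring

/-- The lattice sums of the higher terms of Stirling's series. -/
lemma hasSum_stirlingSum_sub (ω β y : ℂ) {N : ℕ} (hN : 1 ≤ N) :
    HasSum (fun n : ℤ => stirlingSum N (latticePoint β y n) - stirlingSum 1 (latticePoint β y n))
      (polylogSum (polylogBranch ω) 1 β y - polylogSum (polylogBranch ω) N β y) := by
  induction N, hN using Nat.le_induction with
  | base => simp
  | succ N hN ih =>
    have h1 := ((summable_latticeSum (m := 2 * N + 1) (by omega) y).hasSum.mul_left
      (β ^ (2 * N + 1))).mul_left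
        (((bernoulli (2 * (N + 1)) : ℚ) : ℂ) / ((2 * N + 2) * (2 * N + 1)))
    have hterm : (fun n : ℤ => stirlingSum (N + 1) (latticePoint β y n) -
        stirlingSum 1 (latticePoint β y n)) = fun n : ℤ =>
        stirlingSum N (latticePoint β y n) - stirlingSum 1 (latticePoint β y n) +
        ((bernoulli (2 * (N + 1)) : ℚ) : ℂ) / ((2 * N + 2) * (2 * N + 1)) *
          (β ^ (2 * N + 1) * (1 / (y + 2 * Real.pi * Complex.I * n) ^ (2 * N + 1))) := by
      funext n
      have h2 : 1 / latticePoint β y n ^ (2 * N + 1) =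
          β ^ (2 * N + 1) * (1 / (y + 2 * Real.pi * Complex.I * n) ^ (2 * N + 1)) := by
        rw [latticePoint, div_pow, one_div_div, mul_one_div]
      rw [stirlingSum_succ, h2]
      ring
    -- Here Li_{-2N}(e^{-y}) is (2N)! times the lattice sum of order 2N + 1, and (2N)!/(2N + 2)! is
    -- the Stirling coefficient 1/((2N + 2)(2N + 1)).
    have hval : polylogSum (polylogBranch ω) 1 β y - polylogSum (polylogBranch ω) (N + 1) β y =
        polylogSum (polylogBranch ω) 1 β y - polylogSum (polylogBranch ω) N β y +
        ((bernoulli (2 * (N + 1)) : ℚ) : ℂ) / ((2 * N + 2) * (2 * N + 1)) *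
          (β ^ (2 * N + 1) * latticeSum (2 * N + 1) y) := by
      rw [polylogSum_succ hN, polylogBranch_neg ω (by omega),
        Nat.factorial_succ, Nat.factorial_succ]
      have h2 : ((2 * N).factorial : ℂ) ≠ 0 := Nat.cast_ne_zero.2 (Nat.factorial_ne_zero _)
      have h3 : (2 * (N : ℂ) + 1) ≠ 0 := by exact_mod_cast Nat.succ_ne_zero (2 * N)
      have h4 : (2 * (N : ℂ) + 2) ≠ 0 := by exact_mod_cast Nat.succ_ne_zero (2 * N + 1)
      have h5 : (2 * (N : ℂ) + 1 + 1) ≠ 0 := by exact_mod_cast Nat.succ_ne_zero (2 * N + 1)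
      push_cast
      field_simp
      ring
    rw [hterm, hval]
    exact ih.add h1

lemma stirlingRemainderOf_eq (N : ℕ) (x l g : ℂ) :
    stirlingRemainderOf N x l g = stirlingRemainderOf 1 x l g -
      (stirlingSum N x - stirlingSum 1 x) := by
  simp only [stirlingRemainderOf]
  ring

lemma stirlingFactor_eq_mul (N : ℕ) (x l : ℂ) :
    stirlingFactor N x l = stirlingFactor 1 x l *
      Complex.exp (stirlingSum N x - stirlingSum 1 x) := by
  rw [stirlingFactor, stirlingFactor, mul_assoc (_ * _), ← Complex.exp_add]
  ring_nf

/-- The product formula on the cut plane. -/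
lemma multipliable_stirlingFactor {ω β : ℂ} (hω : 0 < ω.re) (hβ : 0 < β.re) {N : ℕ} (hN : 1 ≤ N)
    {y : ℂ} (hy : y ∈ cutPlane ω) :
    Multipliable (fun n : ℤ => stirlingFactor N (latticePoint β y n) (latticeLog ω β y n)) ∧
      qPochhammerInf (Complex.exp (-y)) (Complex.exp (-β)) =
        Complex.exp (polylogSum (polylogBranch ω) N β y) *
          ∏' n : ℤ, stirlingFactor N (latticePoint β y n) (latticeLog ω β y n) := by
  have h1 := (stirlingFactor_prod_differentiable hω hβ).1 y hy
  have h2 := h1.hasProd.mul (hasSum_stirlingSum_sub ω β y hN).cexp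
  have h3 : (fun n : ℤ => stirlingFactor N (latticePoint β y n) (latticeLog ω β y n)) =
      fun n : ℤ => stirlingFactor 1 (latticePoint β y n) (latticeLog ω β y n) *
        (Complex.exp ∘ fun n : ℤ =>
          stirlingSum N (latticePoint β y n) - stirlingSum 1 (latticePoint β y n)) n :=
    funext fun n => stirlingFactor_eq_mul N _ _
  rw [h3]
  refine ⟨h2.multipliable, ?_⟩
  rw [h2.tprod_eq, qPochhammerInf_eq_one hω hβ hy, mul_left_comm, ← Complex.exp_add,
    add_sub_cancel, mul_comm]

/-- The formula with logarithms on the cut plane. -/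
lemma summable_stirlingRemainderOf {ω β : ℂ} (hω : 0 < ω.re) (hβ : 0 < β.re) {N : ℕ} (hN : 1 ≤ N)
    {y : ℂ} (hy : y ∈ cutPlane ω) {g : ℤ → ℂ}
    (hg : ∀ n : ℤ, Complex.exp (g n) = Complex.Gamma (latticePoint β y n))
    (hgl : ∀ᶠ n : ℤ in cofinite, g n = logGamma (latticePoint β y n)) :
    Summable (fun n : ℤ =>
      stirlingRemainderOf N (latticePoint β y n) (latticeLog ω β y n) (g n)) ∧
      qPochhammerInf (Complex.exp (-y)) (Complex.exp (-β)) =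
        Complex.exp (polylogSum (polylogBranch ω) N β y - ∑' n : ℤ,
          stirlingRemainderOf N (latticePoint β y n) (latticeLog ω β y n) (g n)) := by
  have hs : Summable (fun n : ℤ =>
      stirlingRemainderOf N (latticePoint β y n) (latticeLog ω β y n) (g n)) := by
    -- The difference from order one is a summable series of powers, so only f_1 has to be
    -- estimated, and only for large |n|, where all branches are principal.
    simp_rw [stirlingRemainderOf_eq N]
    refine Summable.sub ?_ (hasSum_stirlingSum_sub ω β y hN).summable
    obtain ⟨C, M, h⟩ := exists_stirlingRemainder_one_bound hω hβ ‖y‖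
    refine Summable.of_norm_bounded_eventually (summable_one_add_abs_rpow_inv.mul_left C) ?_
    filter_upwards [eventually_le_abs_intCast M, hgl] with n hn hgn
    obtain ⟨-, h2, h3⟩ := h y le_rfl n hn
    rw [h2, hgn]
    exact h3
  refine ⟨hs, ?_⟩
  have hprod : (fun n : ℤ => stirlingFactor N (latticePoint β y n) (latticeLog ω β y n)) =
      Complex.exp ∘ fun n : ℤ =>
        -stirlingRemainderOf N (latticePoint β y n) (latticeLog ω β y n) (g n) :=
    funext fun n => stirlingFactor_eq_exp (hg n)
  rw [(multipliable_stirlingFactor hω hβ hN hy).2, hprod, hs.hasSum.neg.cexp.tprod_eq,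
    ← Complex.exp_add, sub_eq_add_neg]

/-! ### The principal case and the explicit form for N = 1. -/

lemma latticeLog_self {β : ℂ} (hβ : 0 < β.re) (y : ℂ) (n : ℤ) :
    latticeLog β β y n = Complex.log (latticePoint β y n) := by
  have hβ0 : β ≠ 0 := fun h => by simp [h] at hβ
  rw [latticeLog, div_self hβ0, Complex.log_one, add_zero, latticePoint]

lemma one_sub_coth_half {y : ℂ} (hy : Complex.exp y - 1 ≠ 0) :
    1 - Complex.cosh (y / 2) / Complex.sinh (y / 2) = -(2 / (Complex.exp y - 1)) := by
  have hE := Complex.exp_ne_zero (y / 2)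
  have h1 : Complex.exp y = Complex.exp (y / 2) ^ 2 := by
    rw [← Complex.exp_nat_mul]
    congr 1
    push_cast
    ring
  rw [h1] at hy ⊢
  have hs : Complex.sinh (y / 2) = (Complex.exp (y / 2) ^ 2 - 1) / (2 * Complex.exp (y / 2)) := by
    rw [Complex.sinh, Complex.exp_neg]
    field_simp
  have hc : Complex.cosh (y / 2) = (Complex.exp (y / 2) ^ 2 + 1) / (2 * Complex.exp (y / 2)) := by
    rw [Complex.cosh, Complex.exp_neg]
    field_simp
  rw [hs, hc]
  field_simp
  ring

lemma stirlingFactor_one_eq {ω β y : ℂ} (n : ℤ) :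
    stirlingFactor 1 (latticePoint β y n) (latticeLog ω β y n) =
      (Real.sqrt (2 * Real.pi) : ℂ) * (Complex.Gamma (latticePoint β y n))⁻¹ *
        Complex.exp ((latticePoint β y n - 1 / 2) * latticeLog ω β y n) *
        Complex.exp (β / (12 * (y + 2 * Real.pi * Complex.I * n)) - latticePoint β y n) := by
  have h1 : stirlingSum 1 (latticePoint β y n) =
      β / (12 * (y + 2 * Real.pi * Complex.I * n)) := by
    rw [stirlingSum_one, latticePoint, mul_div_assoc', one_div_div]
  rw [stirlingFactor, h1, mul_assoc (_ * _) (Complex.exp _), ← Complex.exp_add]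
  ring_nf

lemma exp_polylogSum_one {ω β y : ℂ} (hy : y ∈ cutPlane ω) :
    Complex.exp (polylogSum (polylogBranch ω) 1 β y) =
      Complex.exp (β * (1 - Complex.cosh (y / 2) / Complex.sinh (y / 2)) / 24 -
        polylogBranch ω 2 y / β) * Complex.exp (-polylogBranch ω 1 y / 2) := by
  rw [one_sub_coth_half (exp_sub_one_ne_zero hy), polylogSum_one, polylogBranch_zero,
    ← Complex.exp_add]
  congr 1
  ring

end

theorem mainTheorem2 :
    -- `Li ω s` is the branch of `y ↦ Li_s(e^{-y})` on `cutPlane ω`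
    ∃ Li : ℂ → ℤ → ℂ → ℂ,
      (∀ ω : ℂ, 0 < ω.re → ∀ s : ℤ, s ≤ 2 → IsPolylogBranch ω s (Li ω s)) ∧
      -- the cut planes cover all `y ∉ 2πiℤ`
      (∀ y : ℂ, (∀ n : ℤ, y ≠ 2 * Real.pi * Complex.I * n) →
        ∃ ω : ℂ, 0 < ω.re ∧ y ∈ cutPlane ω) ∧
      -- the identity with the principal branch of `f_N`
      (∀ (N : ℕ) (β : ℂ), 1 ≤ N → 0 < β.re → ∀ y ∈ cutPlane β,
        Summable (fun n : ℤ => stirlingRemainder N (latticePoint β y n)) ∧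
        qPochhammerInf (Complex.exp (-y)) (Complex.exp (-β)) =
          Complex.exp (polylogSum (Li β) N β y -
            ∑' n : ℤ, stirlingRemainder N (latticePoint β y n))) ∧
      -- the identity with the branches on an arbitrary cut plane
      (∀ (N : ℕ) (β ω : ℂ), 1 ≤ N → 0 < β.re → 0 < ω.re → ∀ y ∈ cutPlane ω,
        (Multipliable (fun n : ℤ =>
            stirlingFactor N (latticePoint β y n) (latticeLog ω β y n)) ∧
          qPochhammerInf (Complex.exp (-y)) (Complex.exp (-β)) =
            Complex.exp (polylogSum (Li ω) N β y) *
              ∏' n : ℤ, stirlingFactor N (latticePoint β y n) (latticeLog ω β y n)) ∧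
        (∀ g : ℤ → ℂ, (∀ n : ℤ, Complex.exp (g n) = Complex.Gamma (latticePoint β y n)) →
          (∀ᶠ n : ℤ in Filter.cofinite, g n = logGamma (latticePoint β y n)) →
          Summable (fun n : ℤ =>
            stirlingRemainderOf N (latticePoint β y n) (latticeLog ω β y n) (g n)) ∧
          qPochhammerInf (Complex.exp (-y)) (Complex.exp (-β)) =
            Complex.exp (polylogSum (Li ω) N β y -
              ∑' n : ℤ,
                stirlingRemainderOf N (latticePoint β y n) (latticeLog ω β y n) (g n)))) ∧
      -- the case `N = 1` written out; `exp (-Li_1(e^{-y}) / 2)` is `(1 - e^{-y})^{1/2}`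
      (∀ β ω : ℂ, 0 < β.re → 0 < ω.re → ∀ y ∈ cutPlane ω,
        Multipliable (fun n : ℤ =>
          (Real.sqrt (2 * Real.pi) : ℂ) * (Complex.Gamma (latticePoint β y n))⁻¹ *
            Complex.exp ((latticePoint β y n - 1 / 2) * latticeLog ω β y n) *
            Complex.exp (β / (12 * (y + 2 * Real.pi * Complex.I * n)) - latticePoint β y n)) ∧
        (Complex.exp (-Li ω 1 y / 2)) ^ 2 = 1 - Complex.exp (-y) ∧
        qPochhammerInf (Complex.exp (-y)) (Complex.exp (-β)) =
          Complex.exp (β * (1 - Complex.cosh (y / 2) / Complex.sinh (y / 2)) / 24 -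
              Li ω 2 y / β) *
            Complex.exp (-Li ω 1 y / 2) *
            ∏' n : ℤ,
              ((Real.sqrt (2 * Real.pi) : ℂ) * (Complex.Gamma (latticePoint β y n))⁻¹ *
                Complex.exp ((latticePoint β y n - 1 / 2) * latticeLog ω β y n) *
                Complex.exp (β / (12 * (y + 2 * Real.pi * Complex.I * n)) -
                  latticePoint β y n))) := by
  refine ⟨polylogBranch, fun ω hω s hs => isPolylogBranch_polylogBranch hω hs,
    fun y hy => exists_mem_cutPlane hy, ?_, ?_, ?_⟩
  · intro N β hN hβ y hy
    -- For ω = β, membership in the cut plane says precisely that every lattice point lies in the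
    -- slit plane, so the principal log Γ is available for all n.
    have hg : ∀ n : ℤ, Complex.exp (logGamma (latticePoint β y n)) =
        Complex.Gamma (latticePoint β y n) := fun n =>
      exp_logGamma ((mem_cutPlane_iff hβ).1 hy n)
    have h := summable_stirlingRemainderOf hβ hβ hN hy hg (Filter.Eventually.of_forall fun _ => rfl)
    simp only [latticeLog_self hβ] at h
    exact h
  · intro N β ω hN hβ hω y hy
    exact ⟨multipliable_stirlingFactor hω hβ hN hy, fun g hg hgl =>
      summable_stirlingRemainderOf hω hβ hN hy hg hgl⟩
  · intro β ω hβ hω y hy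
    obtain ⟨h1, h2⟩ := multipliable_stirlingFactor hω hβ le_rfl hy
    simp only [stirlingFactor_one_eq] at h1 h2
    refine ⟨h1, ?_, ?_⟩
    · rw [← exp_neg_polylogBranch_one hω hy, ← Complex.exp_nat_mul]
      congr 1
      push_cast
      ring
    · rw [h2, exp_polylogSum_one hy]
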